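/- **Setting.** Let $\tau,r\in\mathbb C$ with $\operatorname{Im}\tau>0$, $r\neq0$. Put $\tilde p=e^{2\pi i\tau}$ and $$\vartheta_1(u|\tau)=2\tilde p^{1/8}(\tilde p;\tilde p)_\infty\sin\pi u\prod_{n\ge1}(1-2\tilde p^n\cos2\pi u+\tilde p^{2n}),\qquad \tilde p^{1/8}=e^{\pi i\tau/4},$$ $$\vartheta_0(u|\tau)=-ie^{\pi i(u+\tau/4)}\vartheta_1(u+\tfrac\tau2|\tau),\quad \vartheta_2(u|\tau)=\vartheta_1(u+\tfrac12|\tau),\quad \vartheta_3(u|\tau)=e^{\pi i(u+\tau/4)}\vartheta_1(u+\tfrac{\tau+1}2|\tau).$$ Let $x^w=e^{-\pi i w/(r\tau)}$ for $w\in\mathbb C$, $\Theta_p(z)=(z;p)_\infty(p/z;p)_\infty(p;p)_\infty$ with $(z;p)_\infty=\prod_{n\ge0}(1-zp^n)$, and $$[u]=x^{\frac{u^2}r-u}\,\Theta_{x^{2r}}(x^{2u}),\qquad C=x^{-r/4}e^{-\pi i/4}\tau^{1/2}\ \text{(principal branch)},$$ so that $[u]=C\,\vartheta_1(\frac ur|\tau)$.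 For integers $n$ fix square roots $\sqrt{[n]}$ (any choice), read $\sqrt{[a][b]}$ as $\sqrt{[a]}\sqrt{[b]}$, let $g_a=\varepsilon_a\sqrt{[a]}$ with signs $\varepsilon_a=\pm1$ $(a\in\mathbb Z)$ satisfying $\varepsilon_a\varepsilon_{a+1}=(-1)^a$, and for integers $a,b$ with $a-b\in\{2,0,-2\}$ let $$(a,b)_2=\left(\prod_{i=0}^{B-1}\frac{[2-i]}{[i+1]}\right)^{-1}\frac{[\frac{a+b}2-1]\,[\frac{a+b}2]\,[\frac{a+b}2+1]}{\sqrt{[a][b]}},\qquad B=\frac{a-b+2}2 .$$ Let $V=\mathbb Cv_+\oplus\mathbb Cv_-$, let $P$ be the flip on $V\otimes V$, $\Pi=\frac12(P+\mathrm{id})$, and let $v^{(2)}_2=v_+\otimes v_+$, $v^{(2)}_0=\frac12(v_+\otimes v_-+v_-\otimes v_+)$, $v^{(2)}_{-2}=v_-\otimes v_-$. For integers $a,b$ with $|a-b|=1$ let $$\psi(u)^a_b=\sum_{\varepsilon=\pm}\psi_\varepsilon(u)^a_b\,v_\varepsilon,\quad \psi_+(u)^a_b=\vartheta_0\!\left(\tfrac{(a-b)u+a}{2r}\Big|\tfrac\tau2\right),\quad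 \psi_-(u)^a_b=\vartheta_3\!\left(\tfrac{(a-b)u+a}{2r}\Big|\tfrac\tau2\right),$$ $$\psi^*_\varepsilon(u)^a_b=-\varepsilon\,\frac{a-b}{2[b][u]}\,C^2\,\psi_{-\varepsilon}(u-1)^a_b ,$$ and put $\psi^*_\varepsilon(u)^a_b=0$ if $|a-b|\neq1$. For $a-b\in\{2,0,-2\}$ the fused intertwining vector is $$\psi^{(2)}(u)^a_b=\Pi\,\psi(u+1)^a_c\otimes\psi(u)^c_b=\sum_{\mu=2,0,-2}\psi^{(2)}_\mu(u)^a_b\,v^{(2)}_\mu ,$$ where $c$ is any integer with $|a-c|=|c-b|=1$, and the fused dual vector has components $$\psi^{*(2)}_\mu(u)^a_b=\sum_{c=b\pm1}\psi^*_{\varepsilon_1}(u+1)^c_b\,\psi^*_{\varepsilon_2}(u)^a_c,\qquad \mu=\varepsilon_1+\varepsilon_2\in\{2,0,-2\}.$$ Finally let $Q=U^tU$ (rows and columns indexed by $2,0,-2$) with $$U=\begin{pmatrix}1&0&0\\0&\xi&0\\0&0&\eta\end{pmatrix}\begin{pmatrix}\frac1{\sqrt2}&0&\frac1{\sqrt2}\\0&1&0\\\frac1{\sqrt2}&0&-\frac1{\sqrt2}\end{pmatrix},\quad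 \xi^2=-\frac12\frac{\vartheta_0(0|\tau)\vartheta_3(\frac1r|\tau)}{\vartheta_0(\frac1r|\tau)\vartheta_3(0|\tau)},\quad \eta^2=-\frac{\vartheta_2(0|\tau)\vartheta_3(\frac1r|\tau)}{\vartheta_2(\frac1r|\tau)\vartheta_3(0|\tau)} .$$ **Theorem.** Let $a,b$ be integers with $a-b\in\{2,0,-2\}$ and let $u\in\mathbb C$. Assume that $[2]$, $[u]$, $[u+1]$, $[\frac{a+b}2-1]$, $[\frac{a+b}2]$ and $[\frac{a+b}2+1]$ are nonzero. (Here $[2]\ne0$ also implies that $[1]$ and $\vartheta_i(\frac1r|\tau)$, $i=0,2,3$, are nonzero, so no denominator vanishes.) Then for each $\mu\in\{2,0,-2\}$ $$\psi^{*(2)}_{\mu}(u)^a_b=-\frac{C^4}{4[u][u+1]}\,\frac{\vartheta_3(0|\tau)}{\vartheta_3(\frac1r|\tau)}\,\frac{g_a}{g_b\,(a,b)_2}\sum_{\mu'=2,0,-2}Q^{\mu'}_{\mu}\,\psi^{(2)}_{\mu'}(u-1)^a_b ,$$ for every choice of $\varepsilon_1,\varepsilon_2$ with $\varepsilon_1+\varepsilon_2=\mu$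 on the left and every admissible intermediate height $c$ on the right. -/

import Mathlib

open scoped TensorProduct

namespace VertexFace

/-! ### Theta functions and the symbol `[u]` -/

/-- `ϑ₁(u|τ) = 2 p̃^{1/8} (p̃;p̃)_∞ sin(πu) ∏_{n ≥ 1} (1 - 2 p̃ⁿ cos(2πu) + p̃²ⁿ)`, where
`p̃ = exp(2πiτ)` and `p̃^{1/8} = exp(πiτ/4)`. -/
noncomputable def theta1 (u τ : ℂ) : ℂ :=
  2 * Complex.exp (Real.pi * Complex.I * τ / 4)
    * (∏' n : ℕ, (1 - Complex.exp (2 * Real.pi * Complex.I * τ) ^ (n + 1)))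
    * Complex.sin (Real.pi * u)
    * ∏' n : ℕ, (1 - 2 * Complex.exp (2 * Real.pi * Complex.I * τ) ^ (n + 1)
          * Complex.cos (2 * Real.pi * u)
        + Complex.exp (2 * Real.pi * Complex.I * τ) ^ (2 * (n + 1)))

noncomputable def theta0 (u τ : ℂ) : ℂ :=
  -Complex.I * Complex.exp (Real.pi * Complex.I * (u + τ / 4)) * theta1 (u + τ / 2) τ

noncomputable def theta2 (u τ : ℂ) : ℂ := theta1 (u + 1 / 2) τ

noncomputable def theta3 (u τ : ℂ) : ℂ :=
  Complex.exp (Real.pi * Complex.I * (u + τ / 4)) * theta1 (u + (τ + 1) / 2) τ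

/-- The power `x^w` of `x = exp(-πi/(rτ))`, i.e. `exp(-πiw/(rτ))`.  With `τ = 2iK/K'` and
`r = K'/λ` this is `x = exp(-πλ/(2K))`, and `x^{2r} = exp(-2πi/τ)`. -/
noncomputable def xpow (τ r w : ℂ) : ℂ :=
  Complex.exp (-(Real.pi * Complex.I * w) / (r * τ))

/-- `(z;p)_∞ = ∏_{n ≥ 0} (1 - z pⁿ)`. -/
noncomputable def poch (z p : ℂ) : ℂ := ∏' n : ℕ, (1 - z * p ^ n)

/-- `Θ_p(z) = (z;p)_∞ (p/z;p)_∞ (p;p)_∞`. -/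
noncomputable def bigTheta (p z : ℂ) : ℂ := poch z p * poch (p / z) p * poch p p

/-- `[u] = x^{u²/r - u} Θ_{x^{2r}}(x^{2u})`. -/
noncomputable def bracket (τ r u : ℂ) : ℂ :=
  xpow τ r (u ^ 2 / r - u) * bigTheta (xpow τ r (2 * r)) (xpow τ r (2 * u))

/-- `C = x^{-r/4} e^{-πi/4} τ^{1/2}` (principal branch), the constant with
`[u] = C ϑ₁(u/r|τ)`. -/
noncomputable def bracketConst (τ r : ℂ) : ℂ :=
  xpow τ r (-r / 4) * Complex.exp (-(Real.pi * Complex.I) / 4) * τ ^ (1 / 2 : ℂ)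

/-! ### The factors `g_a` and `(a,b)_M`

Here `s : ℤ → ℂ` is a choice of square roots, `s n = √[n]`, and `√([a][b])` is `s a * s b`. -/

/-- `[A; B] = [A][A-1]⋯[A-B+1] / ([B][B-1]⋯[1])`. -/
noncomputable def bracketBinom (τ r : ℂ) (A B : ℕ) : ℂ :=
  (∏ i ∈ Finset.range B, bracket τ r ((A : ℂ) - i))
    / ∏ i ∈ Finset.range B, bracket τ r ((i : ℂ) + 1)

/-- `[A, B] = [A][A+1]⋯[B]`. -/
noncomputable def bracketProd (τ r : ℂ) (A B : ℤ) : ℂ :=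
  ∏ k ∈ Finset.Icc A B, bracket τ r (k : ℂ)

/-- `(a,b)_M`, for integers `a, b` with `a - b ∈ {-M, -M+2, …, M}`. -/
noncomputable def pairing (τ r : ℂ) (s : ℤ → ℂ) (M : ℕ) (a b : ℤ) : ℂ :=
  (bracketBinom τ r M ((a - b + M) / 2).toNat)⁻¹
    * (bracketProd τ r ((a + b - M) / 2) ((a + b + M) / 2) / (s a * s b))

/-- `g_a = ε_a √[a]`. -/
noncomputable def gFactor (s : ℤ → ℂ) (ε : ℤ → ℤˣ) (a : ℤ) : ℂ := ((ε a : ℤ) : ℂ) * s a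

/-! ### The space `V = ℂ v₊ ⊕ ℂ v₋` and the symmetric tensors -/

/-- `V`, with basis indexed by the signs `ℤˣ = {1, -1}`. -/
abbrev V : Type := ℤˣ → ℂ

/-- The basis vector `v_ε`. -/
def v (ε : ℤˣ) : V := Pi.single ε 1

/-- `Π = (P + id)/2`, with `P` the flip. -/
noncomputable def symProj : V ⊗[ℂ] V →ₗ[ℂ] V ⊗[ℂ] V :=
  (1 / 2 : ℂ) • ((TensorProduct.comm ℂ V V).toLinearMap + LinearMap.id)

/-- The weights `2, 0, -2`, in this order. -/
def weight : Fin 3 → ℤ := ![2, 0, -2]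

/-- The basis `v⁽²⁾_2 = v₊ ⊗ v₊`, `v⁽²⁾_0 = (v₊ ⊗ v₋ + v₋ ⊗ v₊)/2`, `v⁽²⁾_{-2} = v₋ ⊗ v₋` of the
symmetric tensors. -/
noncomputable def symVec : Fin 3 → V ⊗[ℂ] V :=
  ![v 1 ⊗ₜ v 1, (1 / 2 : ℂ) • (v 1 ⊗ₜ v (-1) + v (-1) ⊗ₜ v 1), v (-1) ⊗ₜ v (-1)]

/-- The coefficient of `v_{ε₁} ⊗ v_{ε₂}` in a tensor. -/
noncomputable def tensorCoeff (w : V ⊗[ℂ] V) (ε₁ ε₂ : ℤˣ) : ℂ :=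
  ((Pi.basisFun ℂ ℤˣ).tensorProduct (Pi.basisFun ℂ ℤˣ)).repr w (ε₁, ε₂)

/-- The coordinates of a symmetric tensor in the basis `symVec`
(see `symProj_eq_sum` and `symCoord_symVec`). -/
noncomputable def symCoord (w : V ⊗[ℂ] V) : Fin 3 → ℂ :=
  ![tensorCoeff w 1 1, tensorCoeff w 1 (-1) + tensorCoeff w (-1) 1, tensorCoeff w (-1) (-1)]

theorem tensorCoeff_tmul (x y : V) (ε₁ ε₂ : ℤˣ) :
    tensorCoeff (x ⊗ₜ y) ε₁ ε₂ = x ε₁ * y ε₂ := by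
  simp [tensorCoeff, mul_comm]

theorem symProj_eq_sum (w : V ⊗[ℂ] V) :
    symProj w = ∑ j, symCoord (symProj w) j • symVec j := by
  have add : ∀ p q : V ⊗[ℂ] V, symCoord (p + q) = symCoord p + symCoord q := by
    intro p q; ext j; fin_cases j <;> simp [symCoord, tensorCoeff]; ring
  have smul : ∀ (k : ℂ) (p : V ⊗[ℂ] V), symCoord (k • p) = k • symCoord p := by
    intro k p; ext j; fin_cases j <;> simp [symCoord, tensorCoeff]; ring
  have dec : ∀ x : V, x = x 1 • v 1 + x (-1) • v (-1) := by
    intro x; funext ε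
    rcases Int.units_eq_one_or ε with rfl | rfl <;> simp [v]
  induction w with
  | zero =>
    have h0 : symCoord 0 = 0 := by simpa using smul 0 0
    simp [h0]
  | add p q hp hq =>
    rw [map_add, add]
    simp only [Pi.add_apply, add_smul, Finset.sum_add_distrib]
    rw [← hp, ← hq]
  | tmul x y =>
    have hS : symProj (x ⊗ₜ[ℂ] y) = (1 / 2 : ℂ) • (y ⊗ₜ x + x ⊗ₜ y) := by simp [symProj]
    have c0 : ∀ p q : V, symCoord (p ⊗ₜ q) 0 = p 1 * q 1 := fun p q => tensorCoeff_tmul p q 1 1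
    have c1 : ∀ p q : V, symCoord (p ⊗ₜ q) 1 = p 1 * q (-1) + p (-1) * q 1 := fun p q =>
      congrArg₂ (· + ·) (tensorCoeff_tmul p q 1 (-1)) (tensorCoeff_tmul p q (-1) 1)
    have c2 : ∀ p q : V, symCoord (p ⊗ₜ q) 2 = p (-1) * q (-1) := fun p q =>
      tensorCoeff_tmul p q (-1) (-1)
    have d2 : symVec 2 = v (-1) ⊗ₜ v (-1) := rfl
    have d1 : symVec 1 = (1 / 2 : ℂ) • (v 1 ⊗ₜ v (-1) + v (-1) ⊗ₜ v 1) := rfl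
    have d0 : symVec 0 = v 1 ⊗ₜ v 1 := rfl
    rw [hS, smul, add]
    simp only [Fin.sum_univ_three, Pi.add_apply, Pi.smul_apply, c0, c1, c2, d0, d1, d2]
    conv_lhs => rw [dec x, dec y]
    simp only [TensorProduct.add_tmul, TensorProduct.tmul_add, ← TensorProduct.smul_tmul',
      TensorProduct.tmul_smul, smul_eq_mul]
    module

theorem symCoord_symVec (i j : Fin 3) : symCoord (symVec j) i = if i = j then 1 else 0 := by
  have h : (1 : ℤˣ) ≠ -1 := by decide
  have h' : (-1 : ℤˣ) ≠ 1 := by decide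
  have e : ∀ ε₁ ε₂, tensorCoeff ((1 / 2 : ℂ) • (v 1 ⊗ₜ v (-1) + v (-1) ⊗ₜ v 1)) ε₁ ε₂
      = 1 / 2 * (v 1 ε₁ * v (-1) ε₂ + v (-1) ε₁ * v 1 ε₂) := by
    intro ε₁ ε₂
    rw [← tensorCoeff_tmul, ← tensorCoeff_tmul]
    simp only [tensorCoeff, map_smul, map_add, Finsupp.smul_apply, Finsupp.add_apply, smul_eq_mul]
  fin_cases j
  · fin_cases i <;> simp [symCoord, symVec, tensorCoeff_tmul, v, h']
  · change symCoord ((1 / 2 : ℂ) • (v 1 ⊗ₜ v (-1) + v (-1) ⊗ₜ v 1)) i = _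
    fin_cases i <;> simp only [symCoord, e] <;> simp [v, h, h']
    norm_num
  · fin_cases i <;> simp [symCoord, symVec, tensorCoeff_tmul, v, h]

/-! ### Intertwining vectors, their duals, and the fusion of both -/

/-- `ψ_ε(u)^a_b` for `|a - b| = 1`: `ψ₊` is `ϑ₀`, `ψ₋` is `ϑ₃`, at `(((a-b)u + a)/(2r) | τ/2)`. -/
noncomputable def psiComp (τ r : ℂ) (ε : ℤˣ) (u : ℂ) (a b : ℤ) : ℂ :=
  if ε = 1 then theta0 ((((a : ℂ) - b) * u + a) / (2 * r)) (τ / 2)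
  else theta3 ((((a : ℂ) - b) * u + a) / (2 * r)) (τ / 2)

/-- `ψ(u)^a_b = ψ₊(u)^a_b v₊ + ψ₋(u)^a_b v₋`. -/
noncomputable def psi (τ r u : ℂ) (a b : ℤ) : V := ∑ ε : ℤˣ, psiComp τ r ε u a b • v ε

/-- `ψ⁽²⁾(u)^a_b = Π (ψ(u+1)^a_c ⊗ ψ(u)^c_b)`, formed with the intermediate height `c`,
`|a - c| = |c - b| = 1`. -/
noncomputable def psi2 (τ r u : ℂ) (a c b : ℤ) : V ⊗[ℂ] V :=
  symProj (psi τ r (u + 1) a c ⊗ₜ psi τ r u c b)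

/-- `ψ*_ε(u)^a_b = -ε (a-b)/(2[b][u]) C² ψ_{-ε}(u-1)^a_b` if `|a - b| = 1`, and `0` otherwise. -/
noncomputable def psiDualComp (τ r : ℂ) (ε : ℤˣ) (u : ℂ) (a b : ℤ) : ℂ :=
  if |a - b| = 1 then
    -((ε : ℤ) : ℂ) * (((a : ℂ) - b) / (2 * bracket τ r b * bracket τ r u))
      * bracketConst τ r ^ 2 * psiComp τ r (-ε) (u - 1) a b
  else 0

/-- The linear form `ψ*(u)^a_b` on `V` with `v_ε ↦ ψ*_ε(u)^a_b`. -/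
noncomputable def psiDual (τ r u : ℂ) (a b : ℤ) : Module.Dual ℂ V :=
  ∑ ε : ℤˣ, psiDualComp τ r ε u a b • LinearMap.proj ε

/-- The linear form `ψ*⁽²⁾(u)^a_b = ∑_{c = b ± 1} ψ*(u+1)^c_b ⊗ ψ*(u)^a_c` on `V ⊗ V`. -/
noncomputable def psiDual2 (τ r u : ℂ) (a b : ℤ) : Module.Dual ℂ (V ⊗[ℂ] V) :=
  ∑ c ∈ ({b + 1, b - 1} : Finset ℤ),
    TensorProduct.dualDistrib ℂ V V (psiDual τ r (u + 1) c b ⊗ₜ psiDual τ r u a c)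

/-! ### The matrix `Q` -/

/-- `U = diag(1, x, y) * ((1/√2, 0, 1/√2), (0, 1, 0), (1/√2, 0, -1/√2))`. -/
noncomputable def gaugeU (x y : ℂ) : Matrix (Fin 3) (Fin 3) ℂ :=
  !![1, 0, 0; 0, x, 0; 0, 0, y]
    * !![1 / (Real.sqrt 2 : ℂ), 0, 1 / (Real.sqrt 2 : ℂ);
         0, 1, 0;
         1 / (Real.sqrt 2 : ℂ), 0, -(1 / (Real.sqrt 2 : ℂ))]

/-- `Q = Uᵗ U`; rows and columns are indexed by the weights `2, 0, -2`. -/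
noncomputable def matQ (x y : ℂ) : Matrix (Fin 3) (Fin 3) ℂ :=
  (gaugeU x y).transpose * gaugeU x y

/-- The prescribed value of `x²`. -/
noncomputable def xSq (τ r : ℂ) : ℂ :=
  -(1 / 2) * (theta0 0 τ * theta3 (1 / r) τ / (theta0 (1 / r) τ * theta3 0 τ))

/-- The prescribed value of `y²`. -/
noncomputable def ySq (τ r : ℂ) : ℂ :=
  -(theta2 0 τ * theta3 (1 / r) τ / (theta2 (1 / r) τ * theta3 0 τ))

end VertexFace

open VertexFace

namespace VertexFace

open Filter Topology

/-! ### The Jacobi triple product -/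

/-! Put t = 1/r. The product formulas turn a product of two theta functions of modulus τ/2, with
arguments α and β, into products of modulus τ with arguments p = α + β and q = α - β. For the fused
vector, the half sum and half difference of the outer coordinates become ϑ₃(p)ϑ₃(q) and -ϑ₂(p)ϑ₂(q),
and the middle coordinate becomes 2ϑ₀(p)ϑ₀(q). In these combinations Q is diagonal, and ξ², η² are
the values for which, up to sign and the common factor ϑ₃(t)/ϑ₃(0), Q multiplies the ϑᵢ term by
ϑᵢ(0)/ϑᵢ(t) for i = 0, 2, 3. The outcome is `gaugedCoord`; it is even in q, and a change of the
intermediate height only changes the sign of q.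

If a - b = ±2, a single height contributes to the dual vector. Its two theta functions have the same
argument w, which gives ϑᵢ(2w)ϑᵢ(0); on the other side q = ±t, so ϑᵢ(t) cancels
(`thetaSign_mul_self`).

If a = b, two heights contribute, with weights 1/[b+1] and 1/[b-1]. After clearing denominators,
with v = b/r, the claim reduces to (ϑ₁(v-t)ϑᵢ(v+t) + ϑ₁(v+t)ϑᵢ(v-t)) ϑᵢ(t)ϑ₁(t) =
ϑᵢ(0)ϑ₁(2t)ϑ₁(v)ϑᵢ(v) for i = 0, 2, 3 (`theta0_addition`, `theta2_addition`, `theta3_addition`,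
combined in `theta1_mul_thetaSign_mul`).

The product formulas are proved on series, by splitting a double sum by parity. The Jacobi triple
product `bigTheta_nome` links the series to the infinite products, and the transformation τ ↦ -1/τ
makes [u] a constant multiple of ϑ₁(u/r). -/

theorem summable_norm_mul_pow {p : ℂ} (hp : ‖p‖ < 1) (z : ℂ) :
    Summable fun n : ℕ => ‖-(z * p ^ n)‖ := by
  simpa [norm_mul, norm_pow] using
    (summable_geometric_of_lt_one (norm_nonneg p) hp).mul_left ‖z‖

theorem hasProd_poch {p : ℂ} (hp : ‖p‖ < 1) (z : ℂ) :
    HasProd (fun n : ℕ => 1 - z * p ^ n) (poch z p) := by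
  have := (multipliable_one_add_of_summable (summable_norm_mul_pow hp z)).hasProd
  simp only [← sub_eq_add_neg] at this
  exact this

theorem tendsto_poch {p : ℂ} (hp : ‖p‖ < 1) (z : ℂ) :
    Tendsto (fun n => ∏ k ∈ Finset.range n, (1 - z * p ^ k)) atTop (𝓝 (poch z p)) :=
  (hasProd_poch hp z).tendsto_prod_nat

theorem poch_ne_zero {p : ℂ} (hp : ‖p‖ < 1) {z : ℂ} (h : ∀ n : ℕ, z * p ^ n ≠ 1) :
    poch z p ≠ 0 := by
  have := tprod_one_add_ne_zero_of_summable (f := fun n : ℕ => -(z * p ^ n))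
    (fun n hn => h n (by linear_combination -hn)) (summable_norm_mul_pow hp z)
  simpa only [poch, sub_eq_add_neg] using this

theorem pow_ne_one_of_norm_lt_one {p : ℂ} (hp : ‖p‖ < 1) (n : ℕ) : p ^ (n + 1) ≠ 1 := by
  intro h
  have : ‖p‖ ^ (n + 1) < 1 := pow_lt_one₀ (norm_nonneg p) hp (by simp)
  rw [← norm_pow, h] at this
  simp at this

/-- `(1 - p)(1 - p²)⋯(1 - pⁿ)`. -/
noncomputable def qFact (p : ℂ) (n : ℕ) : ℂ := ∏ k ∈ Finset.range n, (1 - p * p ^ k)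

theorem qFact_succ (p : ℂ) (n : ℕ) : qFact p (n + 1) = qFact p n * (1 - p ^ (n + 1)) := by
  rw [qFact, Finset.prod_range_succ, ← pow_succ', ← qFact]

theorem qFact_ne_zero {p : ℂ} (hp : ‖p‖ < 1) (n : ℕ) : qFact p n ≠ 0 := by
  refine Finset.prod_ne_zero_iff.2 fun k _ h => pow_ne_one_of_norm_lt_one hp k ?_
  rw [pow_succ']
  linear_combination -h

theorem poch_self_ne_zero {p : ℂ} (hp : ‖p‖ < 1) : poch p p ≠ 0 :=
  poch_ne_zero hp fun n => by rw [← pow_succ']; exact pow_ne_one_of_norm_lt_one hp n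

theorem tendsto_qFact {p : ℂ} (hp : ‖p‖ < 1) : Tendsto (qFact p) atTop (𝓝 (poch p p)) :=
  tendsto_poch hp p

/-- The reciprocal of `qFact`, extended by zero to the negative integers. -/
noncomputable def qFactInv (p : ℂ) (k : ℤ) : ℂ := if 0 ≤ k then (qFact p k.toNat)⁻¹ else 0

/-- The extension by zero is consistent with the recursion at k = 0, because the factor 1 - p⁰
vanishes. Hence the recurrence for the triple product coefficients needs no boundary cases. -/
theorem qFactInv_sub_one {p : ℂ} (hp : ‖p‖ < 1) (k : ℤ) :
    qFactInv p (k - 1) = (1 - p ^ k) * qFactInv p k := by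
  rcases lt_trichotomy k 0 with h | rfl | h
  · simp [qFactInv, not_le.2 h, show ¬ (1 ≤ k) by omega]
  · simp [qFactInv]
  · obtain ⟨n, rfl⟩ : ∃ n : ℕ, k = n + 1 := ⟨(k - 1).toNat, by omega⟩
    have h1 : ((n : ℤ) + 1).toNat = n + 1 := by omega
    have h2 : (0 : ℤ) ≤ (n : ℤ) + 1 := by omega
    have h3 : (1 : ℂ) - p ^ (n + 1) ≠ 0 := fun h =>
      pow_ne_one_of_norm_lt_one hp n (by linear_combination -h)
    have h4 : p ^ ((n : ℤ) + 1) = p ^ (n + 1) := by exact_mod_cast zpow_natCast p (n + 1)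
    have h5 := qFact_ne_zero hp n
    simp only [qFactInv, add_sub_cancel_right, h1, h2, if_true, h4, qFact_succ,
      Int.natCast_nonneg, Int.toNat_natCast]
    field_simp

theorem tendsto_qFactInv {p : ℂ} (hp : ‖p‖ < 1) {f : ℕ → ℤ} (hf : Tendsto f atTop atTop) :
    Tendsto (fun n => qFactInv p (f n)) atTop (𝓝 (poch p p)⁻¹) := by
  have h1 : Tendsto (fun n => (qFact p (f n).toNat)⁻¹) atTop (𝓝 (poch p p)⁻¹) := by
    refine ((tendsto_qFact hp).comp ?_).inv₀ (poch_self_ne_zero hp)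
    refine tendsto_atTop.2 fun b => ?_
    filter_upwards [hf.eventually_ge_atTop (b : ℤ)] with n hn
    omega
  refine h1.congr' ?_
  filter_upwards [hf.eventually_ge_atTop 0] with n hn
  simp [qFactInv, hn]

theorem exists_norm_qFactInv_le {p : ℂ} (hp : ‖p‖ < 1) : ∃ M, ∀ k, ‖qFactInv p k‖ ≤ M := by
  obtain ⟨M, hM⟩ := (Metric.isBounded_range_of_tendsto _
    ((tendsto_qFact hp).inv₀ (poch_self_ne_zero hp))).exists_norm_le
  refine ⟨M, fun k => ?_⟩
  rw [qFactInv]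
  split_ifs
  · exact hM _ ⟨k.toNat, rfl⟩
  · simpa using (norm_nonneg _).trans (hM _ ⟨0, rfl⟩)

theorem exists_norm_qFact_le {p : ℂ} (hp : ‖p‖ < 1) : ∃ M, ∀ k, ‖qFact p k‖ ≤ M := by
  obtain ⟨M, hM⟩ := (Metric.isBounded_range_of_tendsto _ (tendsto_qFact hp)).exists_norm_le
  exact ⟨M, fun k => hM _ ⟨k, rfl⟩⟩

/-- The nome `exp(2πiτ)`. -/
noncomputable def nome (τ : ℂ) : ℂ := Complex.exp (2 * Real.pi * Complex.I * τ)

theorem norm_nome_lt_one {τ : ℂ} (hτ : 0 < τ.im) : ‖nome τ‖ < 1 := by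
  have := UpperHalfPlane.norm_exp_two_pi_I_lt_one ⟨τ, hτ⟩
  simpa [nome] using this

theorem nome_zpow (τ : ℂ) (k : ℤ) :
    nome τ ^ k = Complex.exp (2 * Real.pi * Complex.I * τ * k) := by
  rw [nome, ← Complex.exp_int_mul]; ring_nf

theorem nome_pow (τ : ℂ) (k : ℕ) :
    nome τ ^ k = Complex.exp (2 * Real.pi * Complex.I * τ * k) := by
  rw [nome, ← Complex.exp_nat_mul]; ring_nf

/-- The coefficients in the finite form of the triple product. -/
noncomputable def tripleCoeff (p : ℂ) (n : ℕ) (j : ℤ) : ℂ :=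
  qFact p (2 * n) * (qFactInv p (n + j) * qFactInv p (n - j))

/-- This compares coefficients after multiplication by (1 - zpⁿ)(1 - pⁿ⁺¹/z) = 1 + p²ⁿ⁺¹ - zpⁿ -
pⁿ⁺¹/z. Once every reciprocal factorial is expressed through those of index n + 1 ± j, an algebraic
identity in pⁿ and pʲ remains. -/
theorem tripleCoeff_succ {p : ℂ} (hp : ‖p‖ < 1) (hp0 : p ≠ 0) (n : ℕ) (j : ℤ) :
    tripleCoeff p (n + 1) j = (1 + p ^ (2 * n + 1)) * tripleCoeff p n j
      + p ^ ((n : ℤ) + 1 - j) * tripleCoeff p n (j - 1)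
      + p ^ ((n : ℤ) + 1 + j) * tripleCoeff p n (j + 1) := by
  have a1 := qFactInv_sub_one hp (n + 1 + j)
  have a2 := qFactInv_sub_one hp (n + j)
  have b1 := qFactInv_sub_one hp (n + 1 - j)
  have b2 := qFactInv_sub_one hp (n - j)
  rw [show (n : ℤ) + 1 + j - 1 = n + j by ring] at a1
  rw [show (n : ℤ) + 1 - j - 1 = n - j by ring] at b1
  simp only [tripleCoeff]
  rw [show (n : ℤ) + (j - 1) = n + j - 1 by ring, show (n : ℤ) - (j - 1) = n + 1 - j by ring,
    show (n : ℤ) + (j + 1) = n + 1 + j by ring, show (n : ℤ) - (j + 1) = n - j - 1 by ring,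
    a2, b2, a1, b1, show 2 * (n + 1) = 2 * n + 1 + 1 by ring, qFact_succ, qFact_succ]
  push_cast
  simp only [zpow_add₀ hp0, zpow_sub₀ hp0, zpow_natCast, zpow_one]
  have hX : p ^ j ≠ 0 := zpow_ne_zero _ hp0
  generalize qFactInv p _ = A
  generalize qFactInv p _ = B
  generalize p ^ j = X at *
  field_simp
  ring

/-- Induction on n. With z = -exp(2πi(w + τ/2)), the j-th theta term equals (-z)ʲ p^(j(j-1)/2), so
multiplication by z or 1/z shifts j at the cost of a sign and a power of p. -/
theorem hasSum_finite_triple_product {τ : ℂ} (hτ : 0 < τ.im) (w : ℂ) (n : ℕ) :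
    HasSum (fun j : ℤ => tripleCoeff (nome τ) n j * jacobiTheta₂_term j w τ)
      ((∏ k ∈ Finset.range n, (1 - nome (w + τ / 2 - 1 / 2) * nome τ ^ k))
        * ∏ k ∈ Finset.range n, (1 - nome τ / nome (w + τ / 2 - 1 / 2) * nome τ ^ k)) := by
  have hp := norm_nome_lt_one hτ
  have hp0 : nome τ ≠ 0 := Complex.exp_ne_zero _
  have hz0 : nome (w + τ / 2 - 1 / 2) ≠ 0 := Complex.exp_ne_zero _
  have hz : nome (w + τ / 2 - 1 / 2)
      = -Complex.exp (2 * Real.pi * Complex.I * (w + τ / 2)) := by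
    rw [nome, show 2 * (Real.pi : ℂ) * Complex.I * (w + τ / 2 - 1 / 2)
      = 2 * Real.pi * Complex.I * (w + τ / 2) - Real.pi * Complex.I by ring, Complex.exp_sub,
      Complex.exp_pi_mul_I]
    ring
  induction n with
  | zero =>
    have : (fun j : ℤ => tripleCoeff (nome τ) 0 j * jacobiTheta₂_term j w τ)
        = fun j => if j = 0 then 1 else 0 := by
      funext j
      rcases lt_trichotomy j 0 with h | rfl | h
      · simp [tripleCoeff, qFactInv, h.ne, not_le.2 h]
      · simp [tripleCoeff, qFactInv, qFact, jacobiTheta₂_term]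
      · simp [tripleCoeff, qFactInv, h.ne', not_le.2 h]
    rw [this]
    simpa using hasSum_ite_eq (0 : ℤ) (1 : ℂ)
  | succ n ih =>
    have h1 := (Equiv.subRight (1 : ℤ)).hasSum_iff.2 ih
    have h2 := (Equiv.addRight (1 : ℤ)).hasSum_iff.2 ih
    have key := ((ih.mul_left (1 + nome τ ^ (2 * n + 1))).add
      (h1.mul_left (-(nome (w + τ / 2 - 1 / 2) * nome τ ^ n)))).add
      (h2.mul_left (-(nome τ / nome (w + τ / 2 - 1 / 2) * nome τ ^ n)))
    rw [Finset.prod_range_succ, Finset.prod_range_succ]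
    have expand : ∀ A B z q N : ℂ, z ≠ 0 → A * (1 - z * N) * (B * (1 - q / z * N))
        = (1 + q * (N * N)) * (A * B) + -(z * N) * (A * B) + -(q / z * N) * (A * B) := by
      intro A B z q N hz
      field_simp
      ring
    rw [expand _ _ _ _ _ hz0, ← pow_add, ← pow_succ', ← two_mul]
    refine (congrArg (fun f => HasSum f _) (funext fun j => ?_)).mpr key
    · rw [tripleCoeff_succ hp hp0]
      have e1 : -(nome (w + τ / 2 - 1 / 2) * nome τ ^ n) * jacobiTheta₂_term (j - 1) w τ
          = nome τ ^ ((n : ℤ) + 1 - j) * jacobiTheta₂_term j w τ := by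
        rw [hz, neg_mul (Complex.exp _) _, neg_neg, nome_zpow, nome_pow,
          jacobiTheta₂_term, jacobiTheta₂_term, ← Complex.exp_add, ← Complex.exp_add, ← Complex.exp_add]
        congr 1
        push_cast
        ring
      have e2 : -(nome τ / nome (w + τ / 2 - 1 / 2) * nome τ ^ n) * jacobiTheta₂_term (j + 1) w τ
          = nome τ ^ ((n : ℤ) + 1 + j) * jacobiTheta₂_term j w τ := by
        rw [hz, div_neg, neg_mul (nome τ / _) _, neg_neg, nome_zpow, nome_pow, jacobiTheta₂_term,
          jacobiTheta₂_term, nome, ← Complex.exp_sub, ← Complex.exp_add, ← Complex.exp_add,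
          ← Complex.exp_add]
        congr 1
        push_cast
        ring
      simp only [Function.comp, Equiv.subRight_apply, Equiv.coe_addRight]
      linear_combination -tripleCoeff (nome τ) n (j - 1) * e1
        - tripleCoeff (nome τ) n (j + 1) * e2

/-- The Jacobi triple product. -/
theorem bigTheta_nome {τ : ℂ} (hτ : 0 < τ.im) (w : ℂ) :
    bigTheta (nome τ) (nome (w + τ / 2 - 1 / 2)) = jacobiTheta₂ w τ := by
  have hp := norm_nome_lt_one hτ
  obtain ⟨M, hM⟩ := exists_norm_qFact_le hp
  obtain ⟨M', hM'⟩ := exists_norm_qFactInv_le hp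
  have hM0 : 0 ≤ M := (norm_nonneg _).trans (hM 0)
  have hM'0 : 0 ≤ M' := (norm_nonneg _).trans (hM' 0)
  have L1 := (tendsto_poch hp (nome (w + τ / 2 - 1 / 2))).mul
    (tendsto_poch hp (nome τ / nome (w + τ / 2 - 1 / 2)))
  have L2 : Tendsto (fun n : ℕ => ∑' j : ℤ,
      tripleCoeff (nome τ) n j * jacobiTheta₂_term j w τ) atTop
      (𝓝 (∑' j : ℤ, (poch (nome τ) (nome τ))⁻¹ * jacobiTheta₂_term j w τ)) := by
    -- The q-factorials and their reciprocals are bounded, so the theta series itself dominates;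
    -- termwise the coefficient tends to (p;p)/(p;p)² = 1/(p;p).
    refine tendsto_tsum_of_dominated_convergence
      (bound := fun j => M * (M' * M') * ‖jacobiTheta₂_term j w τ‖)
      (((summable_jacobiTheta₂_term_iff w τ).2 hτ).norm.mul_left _) (fun j => ?_) ?_
    · refine Tendsto.mul_const _ ?_
      have t1 : Tendsto (fun n : ℕ => (n : ℤ) + j) atTop atTop :=
        tendsto_atTop_add_const_right _ _ tendsto_natCast_atTop_atTop
      have t2 : Tendsto (fun n : ℕ => (n : ℤ) - j) atTop atTop :=
        tendsto_atTop_add_const_right _ _ tendsto_natCast_atTop_atTop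
      have t3 : Tendsto (fun n : ℕ => 2 * n) atTop atTop :=
        tendsto_id.const_mul_atTop' two_pos
      have := ((tendsto_qFact hp).comp t3).mul
        ((tendsto_qFactInv hp t1).mul (tendsto_qFactInv hp t2))
      rwa [mul_inv_cancel_left₀ (poch_self_ne_zero hp)] at this
    · refine Eventually.of_forall fun n j => ?_
      rw [norm_mul, tripleCoeff, norm_mul, norm_mul]
      gcongr
      · exact hM _
      · exact hM' _
      · exact hM' _
  have L3 := tendsto_nhds_unique L1
    (L2.congr fun n => (hasSum_finite_triple_product hτ w n).tsum_eq)
  rw [tsum_mul_left] at L3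
  rw [bigTheta, L3, mul_comm, mul_inv_cancel_left₀ (poch_self_ne_zero hp), jacobiTheta₂]

/-! ### The theta functions as series -/

theorem poch_eq_mul {p : ℂ} (hp : ‖p‖ < 1) (z : ℂ) : poch z p = (1 - z) * poch (z * p) p := by
  have h := (hasProd_poch hp (z * p)).multipliable
  have h' : Multipliable fun n : ℕ => 1 - z * p ^ (n + 1) := by
    simpa only [pow_succ', mul_assoc] using h
  have := tprod_eq_zero_mul' (f := fun n : ℕ => 1 - z * p ^ n) h'
  simpa only [poch, pow_zero, mul_one, pow_succ', mul_assoc] using this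

theorem jacobiTheta₂_sub_left' (z τ : ℂ) :
    jacobiTheta₂ (z - τ) τ = Complex.exp (Real.pi * Complex.I * (2 * z - τ)) * jacobiTheta₂ z τ := by
  have h := jacobiTheta₂_add_left' (z - τ) τ
  rw [sub_add_cancel] at h
  rw [h, ← mul_assoc, ← Complex.exp_add]
  ring_nf
  simp

theorem theta1_eq_bigTheta {τ : ℂ} (hτ : 0 < τ.im) (u : ℂ) :
    theta1 u τ = Complex.I * Complex.exp (Real.pi * Complex.I * τ / 4)
      * Complex.exp (-(Real.pi * Complex.I * u)) * bigTheta (nome τ) (nome u) := by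
  have hp := norm_nome_lt_one hτ
  have hz : nome u ≠ 0 := Complex.exp_ne_zero _
  have h1 : (∏' n : ℕ, (1 - nome τ ^ (n + 1))) = poch (nome τ) (nome τ) := by
    simp only [poch, pow_succ']
  have hcos : 2 * Complex.cos (2 * Real.pi * u) = nome u + (nome u)⁻¹ := by
    rw [Complex.cos, nome, ← Complex.exp_neg]
    ring_nf
  have h2 : (∏' n : ℕ, (1 - 2 * nome τ ^ (n + 1) * Complex.cos (2 * Real.pi * u)
        + nome τ ^ (2 * (n + 1)))) = poch (nome u * nome τ) (nome τ)
          * poch (nome τ / nome u) (nome τ) := by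
    rw [← ((hasProd_poch hp _).mul (hasProd_poch hp _)).tprod_eq]
    refine tprod_congr fun n => ?_
    rw [mul_right_comm, hcos]
    field_simp
    ring
  have hsin : Complex.sin (Real.pi * u)
      = Complex.I / 2 * Complex.exp (-(Real.pi * Complex.I * u)) * (1 - nome u) := by
    have : Complex.exp (-(Real.pi * Complex.I * u)) * nome u
        = Complex.exp (Real.pi * u * Complex.I) := by
      rw [nome, ← Complex.exp_add]
      ring_nf
    rw [Complex.sin, mul_sub, mul_assoc _ _ (nome u), this]
    ring_nf
  change 2 * Complex.exp (Real.pi * Complex.I * τ / 4) * (∏' n : ℕ, (1 - nome τ ^ (n + 1)))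
    * Complex.sin (Real.pi * u) * (∏' n : ℕ, (1 - 2 * nome τ ^ (n + 1)
      * Complex.cos (2 * Real.pi * u) + nome τ ^ (2 * (n + 1)))) = _
  -- The sine supplies the factor 1 - z missing from (zp;p)_∞.
  rw [h1, h2, hsin, bigTheta, poch_eq_mul hp (nome u)]
  ring

theorem theta1_eq {τ : ℂ} (hτ : 0 < τ.im) (u : ℂ) :
    theta1 u τ = Complex.I * Complex.exp (Real.pi * Complex.I * (τ / 4 - u))
      * jacobiTheta₂ (u - τ / 2 + 1 / 2) τ := by
  rw [theta1_eq_bigTheta hτ, ← bigTheta_nome hτ, mul_assoc Complex.I, ← Complex.exp_add]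
  ring_nf

theorem exp_add_pi_mul_I_div_two (z : ℂ) :
    Complex.exp (z + Real.pi * Complex.I / 2) = Complex.I * Complex.exp z := by
  rw [Complex.exp_add, show (Real.pi : ℂ) * Complex.I / 2 = Real.pi / 2 * Complex.I by ring,
    Complex.exp_pi_div_two_mul_I, mul_comm]

theorem theta0_eq {τ : ℂ} (hτ : 0 < τ.im) (u : ℂ) :
    theta0 u τ = jacobiTheta₂ (u + 1 / 2) τ := by
  rw [theta0, theta1_eq hτ, add_sub_cancel_right]
  have : Complex.exp (Real.pi * Complex.I * (u + τ / 4))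
      * Complex.exp (Real.pi * Complex.I * (τ / 4 - (u + τ / 2))) = 1 := by
    rw [← Complex.exp_add, ← Complex.exp_zero]
    ring_nf
  linear_combination (-Complex.I * Complex.I * jacobiTheta₂ (u + 1 / 2) τ) * this
    - jacobiTheta₂ (u + 1 / 2) τ * Complex.I_mul_I

theorem theta3_eq {τ : ℂ} (hτ : 0 < τ.im) (u : ℂ) : theta3 u τ = jacobiTheta₂ u τ := by
  rw [theta3, theta1_eq hτ, show u + (τ + 1) / 2 - τ / 2 + 1 / 2 = u + 1 by ring,
    jacobiTheta₂_add_left]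
  have : Complex.I * Complex.exp (Real.pi * Complex.I * (τ / 4 - (u + (τ + 1) / 2)))
      = Complex.exp (-(Real.pi * Complex.I * (u + τ / 4))) := by
    rw [← exp_add_pi_mul_I_div_two]
    ring_nf
  rw [this, ← mul_assoc, ← Complex.exp_add, add_neg_cancel, Complex.exp_zero, one_mul]

theorem theta2_eq_sub {τ : ℂ} (hτ : 0 < τ.im) (u : ℂ) :
    theta2 u τ = Complex.exp (Real.pi * Complex.I * (τ / 4 - u))
      * jacobiTheta₂ (u - τ / 2) τ := by
  rw [theta2, theta1_eq hτ, ← exp_add_pi_mul_I_div_two,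
    show u + 1 / 2 - τ / 2 + 1 / 2 = u - τ / 2 + 1 by ring, jacobiTheta₂_add_left]
  ring_nf

theorem theta2_eq {τ : ℂ} (hτ : 0 < τ.im) (u : ℂ) :
    theta2 u τ = Complex.exp (Real.pi * Complex.I * (τ / 4 + u))
      * jacobiTheta₂ (u + τ / 2) τ := by
  rw [theta2_eq_sub hτ, show u - τ / 2 = u + τ / 2 - τ by ring, jacobiTheta₂_sub_left',
    ← mul_assoc, ← Complex.exp_add]
  ring_nf

section Symmetries

variable {τ : ℂ}

theorem theta1_eq_theta2 (u : ℂ) : theta1 u τ = theta2 (u - 1 / 2) τ := by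
  rw [theta2, sub_add_cancel]

theorem theta3_add_half (hτ : 0 < τ.im) (u : ℂ) : theta3 (u + 1 / 2) τ = theta0 u τ := by
  rw [theta3_eq hτ, theta0_eq hτ]

theorem theta0_add_half (hτ : 0 < τ.im) (u : ℂ) : theta0 (u + 1 / 2) τ = theta3 u τ := by
  rw [theta3_eq hτ, theta0_eq hτ, add_assoc, add_halves, jacobiTheta₂_add_left]

theorem theta3_sub_half (hτ : 0 < τ.im) (u : ℂ) : theta3 (u - 1 / 2) τ = theta0 u τ := by
  rw [← theta0_add_half hτ, sub_add_cancel]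

theorem theta3_neg (hτ : 0 < τ.im) (u : ℂ) : theta3 (-u) τ = theta3 u τ := by
  rw [theta3_eq hτ, theta3_eq hτ, jacobiTheta₂_neg_left]

theorem theta0_neg (hτ : 0 < τ.im) (u : ℂ) : theta0 (-u) τ = theta0 u τ := by
  rw [← theta3_add_half hτ, ← theta3_sub_half hτ, ← theta3_neg hτ]
  ring_nf

theorem theta2_neg (hτ : 0 < τ.im) (u : ℂ) : theta2 (-u) τ = theta2 u τ := by
  rw [theta2_eq hτ, theta2_eq_sub hτ, ← jacobiTheta₂_neg_left]
  ring_nf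

theorem theta1_neg (u : ℂ) : theta1 (-u) τ = -theta1 u τ := by
  simp [theta1]

theorem theta1_zero : theta1 0 τ = 0 := by simp [theta1]

theorem theta1_add_one (u : ℂ) : theta1 (u + 1) τ = -theta1 u τ := by
  have h1 : (Real.pi : ℂ) * (u + 1) = Real.pi * u + Real.pi := by ring
  have h2 : 2 * (Real.pi : ℂ) * (u + 1) = 2 * Real.pi * u + 2 * Real.pi := by ring
  simp only [theta1, h1, h2, Complex.sin_add_pi, Complex.cos_add_two_pi]
  ring

theorem theta2_add_half (u : ℂ) : theta2 (u + 1 / 2) τ = -theta1 u τ := by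
  rw [theta2, add_assoc, add_halves, theta1_add_one]

theorem theta2_add_one (u : ℂ) : theta2 (u + 1) τ = -theta2 u τ := by
  rw [theta2, theta2, add_right_comm, theta1_add_one]

end Symmetries

/-! ### The modular shift -/

/-- Since n² and n have the same parity, exp(πin²) = exp(πin). Through this shift every statement
about ϑ₀ yields one about ϑ₃. -/
theorem jacobiTheta₂_add_one_right (z τ : ℂ) :
    jacobiTheta₂ z (τ + 1) = jacobiTheta₂ (z + 1 / 2) τ := by
  refine tsum_congr fun n => ?_
  rw [jacobiTheta₂_term, jacobiTheta₂_term]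
  obtain ⟨k, hk⟩ := Int.even_mul_succ_self (n - 1)
  have hk' : (n : ℂ) ^ 2 - n = 2 * k := by
    have : n ^ 2 - n = 2 * k := by linarith
    exact_mod_cast this
  rw [Complex.exp_eq_exp_iff_exists_int]
  refine ⟨k, ?_⟩
  linear_combination (Real.pi * Complex.I) * hk'

theorem im_add_one_pos {τ : ℂ} (hτ : 0 < τ.im) : 0 < (τ + 1).im := by simpa using hτ

theorem theta0_add_one_right {τ : ℂ} (hτ : 0 < τ.im) (u : ℂ) :
    theta0 u (τ + 1) = theta3 u τ := by
  rw [theta0_eq (im_add_one_pos hτ), theta3_eq hτ, jacobiTheta₂_add_one_right, add_assoc,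
    add_halves, jacobiTheta₂_add_left]

theorem theta1_add_one_right {τ : ℂ} (hτ : 0 < τ.im) (u : ℂ) :
    theta1 u (τ + 1) = Complex.exp (Real.pi * Complex.I / 4) * theta1 u τ := by
  rw [theta1_eq (im_add_one_pos hτ), theta1_eq hτ, jacobiTheta₂_add_one_right,
    show (Real.pi : ℂ) * Complex.I * ((τ + 1) / 4 - u)
      = Real.pi * Complex.I / 4 + Real.pi * Complex.I * (τ / 4 - u) by ring, Complex.exp_add]
  ring_nf

/-! ### Product formulas -/

theorem hasSum_jacobiTheta₂_mul {τ : ℂ} (hτ : 0 < τ.im) (z w : ℂ) :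
    HasSum (fun k : ℤ × ℤ => jacobiTheta₂_term k.1 z τ * jacobiTheta₂_term k.2 w τ)
      (jacobiTheta₂ z τ * jacobiTheta₂ w τ) := by
  have hz := ((summable_jacobiTheta₂_term_iff z τ).2 hτ).norm
  have hw := ((summable_jacobiTheta₂_term_iff w τ).2 hτ).norm
  rw [jacobiTheta₂, jacobiTheta₂, tsum_mul_tsum_of_summable_norm hz hw]
  exact (summable_mul_of_summable_norm hz hw).hasSum

/-- A sum over pairs of integers splits according to the parity of the difference. -/
theorem hasSum_int_prod_of_parity {f : ℤ × ℤ → ℂ} {a b : ℂ}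
    (ha : HasSum (fun k : ℤ × ℤ => f (k.1 + k.2, k.1 - k.2)) a)
    (hb : HasSum (fun k : ℤ × ℤ => f (k.1 + k.2 + 1, k.1 - k.2)) b) : HasSum f (a + b) := by
  let E : ℤ × ℤ → ℤ × ℤ := fun k => (k.1 + k.2, k.1 - k.2)
  let O : ℤ × ℤ → ℤ × ℤ := fun k => (k.1 + k.2 + 1, k.1 - k.2)
  have hE : E.Injective := by
    rintro ⟨a, b⟩ ⟨c, d⟩ h
    simp only [E, Prod.mk.injEq] at h ⊢
    omega
  have hO : O.Injective := by
    rintro ⟨a, b⟩ ⟨c, d⟩ h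
    simp only [O, Prod.mk.injEq] at h ⊢
    omega
  have hEO : IsCompl (Set.range E) (Set.range O) := by
    refine isCompl_iff.2 ⟨Set.disjoint_left.2 ?_, codisjoint_iff_le_sup.2 fun k _ => ?_⟩
    · rintro _ ⟨k, rfl⟩ ⟨l, h⟩
      simp only [E, O, Prod.mk.injEq] at h
      omega
    · obtain ⟨a, b⟩ := k
      rcases Int.even_or_odd' (a - b) with ⟨l, h | h⟩
      · exact Or.inl ⟨(a - l, l), by simp only [E, Prod.mk.injEq]; omega⟩
      · exact Or.inr ⟨(b + l, l), by simp only [O, Prod.mk.injEq]; omega⟩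
  exact (hE.hasSum_range_iff.2 ha).add_isCompl hEO (hO.hasSum_range_iff.2 hb)

/-- For m = k + l, n = k - l one has m² + n² = 2(k² + l²), so pairs of equal parity give a product
of two series of modulus 2σ. Pairs of opposite parity give the same with arguments shifted by σ. -/
theorem jacobiTheta₂_mul_jacobiTheta₂ {σ : ℂ} (hσ : 0 < σ.im) (x y : ℂ) :
    jacobiTheta₂ x σ * jacobiTheta₂ y σ
      = jacobiTheta₂ (x + y) (2 * σ) * jacobiTheta₂ (x - y) (2 * σ)
        + Complex.exp (Real.pi * Complex.I * (σ + 2 * x))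
          * (jacobiTheta₂ (x + y + σ) (2 * σ) * jacobiTheta₂ (x - y + σ) (2 * σ)) := by
  have h2 : 0 < (2 * σ).im := by simpa using hσ
  refine (hasSum_jacobiTheta₂_mul hσ x y).unique (hasSum_int_prod_of_parity ?_ ?_)
  · refine (congrArg (fun f => HasSum f _) (funext fun k => ?_)).mpr
      (hasSum_jacobiTheta₂_mul h2 (x + y) (x - y))
    simp only [jacobiTheta₂_term, ← Complex.exp_add]
    congr 1
    push_cast
    ring
  · refine (congrArg (fun f => HasSum f _) (funext fun k => ?_)).mpr
      ((hasSum_jacobiTheta₂_mul h2 (x + y + σ) (x - y + σ)).mul_left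
        (Complex.exp (Real.pi * Complex.I * (σ + 2 * x))))
    simp only [jacobiTheta₂_term, ← Complex.exp_add]
    congr 1
    push_cast
    ring

theorem im_half_pos {τ : ℂ} (hτ : 0 < τ.im) : 0 < (τ / 2).im := by
  simpa using half_pos hτ

section Products

variable {τ : ℂ} (hτ : 0 < τ.im) (x y : ℂ)

include hτ

theorem theta3_mul_theta3 : theta3 x (τ / 2) * theta3 y (τ / 2)
    = theta3 (x + y) τ * theta3 (x - y) τ + theta2 (x + y) τ * theta2 (x - y) τ := by
  have h := jacobiTheta₂_mul_jacobiTheta₂ (im_half_pos hτ) x y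
  rw [mul_div_cancel₀ τ two_ne_zero] at h
  rw [theta3_eq (im_half_pos hτ), theta3_eq (im_half_pos hτ), theta3_eq hτ, theta3_eq hτ,
    theta2_eq hτ, theta2_eq hτ, h, mul_mul_mul_comm, ← Complex.exp_add]
  ring_nf

theorem theta0_mul_theta0 : theta0 x (τ / 2) * theta0 y (τ / 2)
    = theta3 (x + y) τ * theta3 (x - y) τ - theta2 (x + y) τ * theta2 (x - y) τ := by
  have h3 : theta3 (x + y + 1) τ = theta3 (x + y) τ := by
    rw [theta3_eq hτ, theta3_eq hτ, jacobiTheta₂_add_left]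
  rw [← theta3_add_half (im_half_pos hτ), ← theta3_add_half (im_half_pos hτ),
    theta3_mul_theta3 hτ, show x + 1 / 2 + (y + 1 / 2) = x + y + 1 by ring,
    add_sub_add_right_eq_sub, h3, theta2_add_one, neg_mul, ← sub_eq_add_neg]

theorem theta3_mul_theta0 : theta3 x (τ / 2) * theta0 y (τ / 2)
    = theta0 (x + y) τ * theta0 (x - y) τ - theta1 (x + y) τ * theta1 (x - y) τ := by
  rw [← theta3_add_half (im_half_pos hτ), theta3_mul_theta3 hτ, ← add_assoc, ← sub_sub,
    theta3_add_half hτ, theta3_sub_half hτ, theta2_add_half, ← theta1_eq_theta2]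
  ring

theorem theta2_mul_theta2 : theta2 x (τ / 2) * theta2 y (τ / 2)
    = theta2 (x + y) τ * theta3 (x - y) τ + theta3 (x + y) τ * theta2 (x - y) τ := by
  have h := jacobiTheta₂_mul_jacobiTheta₂ (im_half_pos hτ) (x + τ / 2 / 2) (y + τ / 2 / 2)
  rw [mul_div_cancel₀ τ two_ne_zero, add_sub_add_right_eq_sub,
    show x + τ / 2 / 2 + (y + τ / 2 / 2) = x + y + τ / 2 by ring,
    show x + y + τ / 2 + τ / 2 = x + y + τ by ring, jacobiTheta₂_add_left'] at h
  have e1 : Complex.exp (Real.pi * Complex.I * (τ / 2 / 4 + x))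
      * Complex.exp (Real.pi * Complex.I * (τ / 2 / 4 + y))
      = Complex.exp (Real.pi * Complex.I * (τ / 4 + (x + y))) := by
    rw [← Complex.exp_add]
    ring_nf
  have e2 : Complex.exp (Real.pi * Complex.I * (τ / 4 + (x + y)))
      * (Complex.exp (Real.pi * Complex.I * (τ / 2 + 2 * (x + τ / 2 / 2)))
        * Complex.exp (-Real.pi * Complex.I * (τ + 2 * (x + y))))
      = Complex.exp (Real.pi * Complex.I * (τ / 4 + (x - y))) := by
    rw [← Complex.exp_add, ← Complex.exp_add]
    ring_nf
  rw [theta2_eq (im_half_pos hτ), theta2_eq (im_half_pos hτ), theta3_eq hτ, theta3_eq hτ,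
    theta2_eq hτ, theta2_eq hτ, mul_mul_mul_comm, h, e1, ← e2]
  ring

theorem theta1_mul_theta2 : theta1 x (τ / 2) * theta2 y (τ / 2)
    = theta1 (x + y) τ * theta0 (x - y) τ + theta0 (x + y) τ * theta1 (x - y) τ := by
  rw [theta1_eq_theta2, theta2_mul_theta2 hτ, sub_add_eq_add_sub, sub_right_comm,
    theta3_sub_half hτ, theta3_sub_half hτ, ← theta1_eq_theta2, ← theta1_eq_theta2]

end Products

/-- By the triple product, a zero forces a factor 1 - zpᵏ, k ∈ ℤ, to vanish. -/
theorem jacobiTheta₂_ne_zero {w τ : ℂ} (hτ : 0 < τ.im)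
    (h : ∀ k n : ℤ, w + τ / 2 - 1 / 2 + k * τ ≠ n) : jacobiTheta₂ w τ ≠ 0 := by
  have hp := norm_nome_lt_one hτ
  have hp0 : nome τ ≠ 0 := Complex.exp_ne_zero _
  have key : ∀ k : ℤ, nome (w + τ / 2 - 1 / 2) * nome τ ^ k ≠ 1 := by
    intro k hk
    rw [nome_zpow, nome, ← Complex.exp_add, Complex.exp_eq_one_iff] at hk
    obtain ⟨n, hn⟩ := hk
    refine h k n (mul_left_cancel₀ Complex.two_pi_I_ne_zero ?_)
    linear_combination hn
  rw [← bigTheta_nome hτ]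
  refine mul_ne_zero (mul_ne_zero (poch_ne_zero hp fun n => ?_) (poch_ne_zero hp fun n hn => ?_))
    (poch_self_ne_zero hp)
  · exact_mod_cast key n
  · refine key (-(n + 1)) ?_
    have hz : nome (w + τ / 2 - 1 / 2) ≠ 0 := Complex.exp_ne_zero _
    have h' : nome τ ^ ((n : ℤ) + 1) = nome τ * nome τ ^ n := by
      rw [zpow_add₀ hp0, zpow_natCast, zpow_one, mul_comm]
    rw [zpow_neg, h']
    rw [div_mul_eq_mul_div, div_eq_one_iff_eq hz] at hn
    rw [hn, mul_inv_cancel₀ hz]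

theorem theta0_zero_ne_zero {τ : ℂ} (hτ : 0 < τ.im) : theta0 0 τ ≠ 0 := by
  rw [theta0_eq hτ]
  refine jacobiTheta₂_ne_zero hτ fun k n h => ?_
  have h1 : ((k : ℝ) + 1 / 2) * τ.im = 0 := by
    have := congrArg Complex.im h
    simp at this
    linarith
  have h2 : (k : ℝ) + 1 / 2 = 0 := (mul_eq_zero.1 h1).resolve_right hτ.ne'
  have h3 : 2 * k + 1 = 0 := by
    have : 2 * (k : ℝ) + 1 = 0 := by linarith
    exact_mod_cast this
  omega

theorem theta2_zero_ne_zero {τ : ℂ} (hτ : 0 < τ.im) : theta2 0 τ ≠ 0 := by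
  rw [theta2_eq hτ]
  refine mul_ne_zero (Complex.exp_ne_zero _) (jacobiTheta₂_ne_zero hτ fun k n h => ?_)
  have h1 : ((k : ℝ) + 1) * τ.im = 0 := by
    have := congrArg Complex.im h
    simp at this
    linarith
  have h2 : (k : ℝ) + 1 = 0 := (mul_eq_zero.1 h1).resolve_right hτ.ne'
  have h3 : (k : ℂ) + 1 = 0 := by exact_mod_cast h2
  have h4 : 2 * (n : ℂ) + 1 = 0 := by linear_combination -2 * h + 2 * τ * h3
  have h5 : 2 * n + 1 = 0 := by exact_mod_cast h4
  omega

theorem theta3_zero_ne_zero {τ : ℂ} (hτ : 0 < τ.im) : theta3 0 τ ≠ 0 := by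
  rw [← theta0_add_one_right hτ]
  exact theta0_zero_ne_zero (im_add_one_pos hτ)

/-! ### Duplication and addition formulas -/

theorem theta1_mul_theta2_self {τ : ℂ} (hτ : 0 < τ.im) (t : ℂ) :
    theta1 t τ * theta2 t τ = theta1 (2 * t) (2 * τ) * theta0 0 (2 * τ) := by
  have h := theta1_mul_theta2 (τ := 2 * τ) (by simpa using hτ) t t
  rwa [mul_div_cancel_left₀ τ two_ne_zero, sub_self, theta1_zero, mul_zero, add_zero,
    ← two_mul] at h

theorem theta1_mul_theta2_zero {τ : ℂ} (hτ : 0 < τ.im) (t : ℂ) :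
    theta1 t τ * theta2 0 τ = 2 * (theta1 t (2 * τ) * theta0 t (2 * τ)) := by
  have h := theta1_mul_theta2 (τ := 2 * τ) (by simpa using hτ) t 0
  rw [mul_div_cancel_left₀ τ two_ne_zero, add_zero, sub_zero] at h
  linear_combination h

/-- Passing to modulus 2τ, the two products on the left have the common term ϑ₁(2v)ϑ₀(2t), while
their other terms cancel because ϑ₁ is odd. The duplication formulas match the rest. -/
theorem theta2_addition {τ : ℂ} (hτ : 0 < τ.im) (v t : ℂ) :
    (theta1 (v - t) τ * theta2 (v + t) τ + theta1 (v + t) τ * theta2 (v - t) τ)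
        * (theta2 t τ * theta1 t τ)
      = theta2 0 τ * theta1 (2 * t) τ * (theta1 v τ * theta2 v τ) := by
  have h2 : 0 < (2 * τ).im := by simpa using hτ
  have h := theta1_mul_theta2 h2 (v - t) (v + t)
  have h' := theta1_mul_theta2 h2 (v + t) (v - t)
  rw [mul_div_cancel_left₀ τ two_ne_zero] at h h'
  rw [show v - t + (v + t) = 2 * v by ring, show v - t - (v + t) = -(2 * t) by ring,
    theta1_neg, theta0_neg h2] at h
  rw [show v + t + (v - t) = 2 * v by ring, show v + t - (v - t) = 2 * t by ring] at h'
  rw [h, h', mul_comm (theta2 t τ), mul_comm (theta2 0 τ), theta1_mul_theta2_self hτ,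
    theta1_mul_theta2_self hτ, theta1_mul_theta2_zero hτ]
  ring

/-- Here the passage is to modulus τ/2: the left side becomes ½ϑ₁(v)ϑ₂(t)·ϑ₁(t)ϑ₂(0), which is
regrouped as ½ϑ₁(t)ϑ₂(t)·ϑ₁(v)ϑ₂(0). -/
theorem theta0_addition {τ : ℂ} (hτ : 0 < τ.im) (v t : ℂ) :
    (theta1 (v - t) τ * theta0 (v + t) τ + theta1 (v + t) τ * theta0 (v - t) τ)
        * (theta0 t τ * theta1 t τ)
      = theta0 0 τ * theta1 (2 * t) τ * (theta1 v τ * theta0 v τ) := by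
  have h1 := theta1_mul_theta2 hτ v t
  have h2 := theta1_mul_theta2_zero (im_half_pos hτ) v
  have h3 := theta1_mul_theta2_zero (im_half_pos hτ) t
  have h4 := theta1_mul_theta2_self (im_half_pos hτ) t
  rw [mul_div_cancel₀ τ two_ne_zero] at h2 h3 h4
  linear_combination (-theta0 t τ * theta1 t τ) * h1
    - theta1 v (τ / 2) * theta2 t (τ / 2) / 2 * h3
    + theta1 v τ * theta0 v τ * h4 + theta1 t (τ / 2) * theta2 t (τ / 2) / 2 * h2

theorem theta3_addition {τ : ℂ} (hτ : 0 < τ.im) (v t : ℂ) :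
    (theta1 (v - t) τ * theta3 (v + t) τ + theta1 (v + t) τ * theta3 (v - t) τ)
        * (theta3 t τ * theta1 t τ)
      = theta3 0 τ * theta1 (2 * t) τ * (theta1 v τ * theta3 v τ) := by
  have h := theta0_addition (im_add_one_pos hτ) v t
  simp only [theta0_add_one_right hτ, theta1_add_one_right hτ] at h
  refine mul_left_cancel₀ (pow_ne_zero 2 (Complex.exp_ne_zero (Real.pi * Complex.I / 4))) ?_
  linear_combination h

section Nonvanishing

variable {τ : ℂ} (hτ : 0 < τ.im) {t : ℂ} (h : theta1 (2 * t) τ ≠ 0)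

include hτ h

/-- The duplication formulas make ϑ₁(2t) vanish wherever ϑ₀(t), ϑ₁(t), ϑ₂(t) or ϑ₃(t) does. At t =
1/r this is how [2] ≠ 0 controls all the denominators. -/
theorem theta1_mul_theta2_ne_zero : theta1 t τ * theta2 t τ ≠ 0 := by
  intro h0
  have h2 : 0 < (2 * τ).im := by simpa using hτ
  rw [theta1_mul_theta2_self hτ] at h0
  have h1 := (mul_eq_zero.1 h0).resolve_right (theta0_zero_ne_zero h2)
  have := theta1_mul_theta2_zero hτ (2 * t)
  rw [h1, zero_mul, mul_zero] at this
  exact mul_ne_zero h (theta2_zero_ne_zero hτ) this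

theorem theta0_ne_zero_of_theta1_two_mul_ne_zero : theta0 t τ ≠ 0 := by
  intro h0
  have h3 := theta1_mul_theta2_zero (im_half_pos hτ) t
  have h4 := theta1_mul_theta2_self (im_half_pos hτ) t
  rw [mul_div_cancel₀ τ two_ne_zero] at h3 h4
  rw [h0, mul_zero, mul_zero] at h3
  rw [(mul_eq_zero.1 h3).resolve_right (theta2_zero_ne_zero (im_half_pos hτ)), zero_mul] at h4
  exact mul_ne_zero h (theta0_zero_ne_zero hτ) h4.symm

theorem theta3_ne_zero_of_theta1_two_mul_ne_zero : theta3 t τ ≠ 0 := by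
  rw [← theta0_add_one_right hτ]
  refine theta0_ne_zero_of_theta1_two_mul_ne_zero (im_add_one_pos hτ) ?_
  rw [theta1_add_one_right hτ]
  exact mul_ne_zero (Complex.exp_ne_zero _) h

end Nonvanishing

/-- The nome x^(2r) belongs to -1/τ, so this is the modular transformation of the theta function.
The value of the constant is irrelevant: the relation between brackets needed later is homogeneous.
-/
theorem exists_bracket_eq {τ r : ℂ} (hτ : 0 < τ.im) (hr : r ≠ 0) :
    ∃ K : ℂ, ∀ u, bracket τ r u = K * theta1 (u / r) τ := by
  have hτ0 : τ ≠ 0 := by rintro rfl; simp at hτ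
  have hτ' : 0 < (-1 / τ).im := by
    rw [neg_div, Complex.neg_im, one_div, Complex.inv_im, neg_div, neg_neg]
    exact div_pos hτ (Complex.normSq_pos.2 hτ0)
  have hS : (-Complex.I * τ) ^ (1 / 2 : ℂ) ≠ 0 := by
    rw [Ne, Complex.cpow_eq_zero_iff]
    simp [hτ0]
  refine ⟨-Complex.I * (-Complex.I * τ) ^ (1 / 2 : ℂ)
    * Complex.exp (Real.pi * Complex.I * ((1 + τ) ^ 2 / (4 * τ) - τ / 4)), fun u => ?_⟩
  have e1 : xpow τ r (2 * r) = nome (-1 / τ) := by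
    rw [xpow, nome]
    congr 1
    field_simp
  have e2 : xpow τ r (2 * u)
      = nome ((-(u / r) + 1 / 2 + τ / 2) / τ + -1 / τ / 2 - 1 / 2) := by
    rw [xpow, nome]
    congr 1
    field_simp
    ring
  have e3 := jacobiTheta₂_functional_equation (-(u / r) + 1 / 2 + τ / 2) τ
  have e4 : jacobiTheta₂ (-(u / r) + 1 / 2 + τ / 2) τ
      = jacobiTheta₂ (u / r - τ / 2 + 1 / 2) τ := by
    rw [← jacobiTheta₂_neg_left, ← jacobiTheta₂_add_left]
    ring_nf
  have e5 : Complex.exp (Real.pi * Complex.I * ((1 + τ) ^ 2 / (4 * τ) - τ / 4))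
      * Complex.exp (Real.pi * Complex.I * (τ / 4 - u / r))
      * Complex.exp (-Real.pi * Complex.I * (-(u / r) + 1 / 2 + τ / 2) ^ 2 / τ)
      = xpow τ r (u ^ 2 / r - u) := by
    rw [xpow, ← Complex.exp_add, ← Complex.exp_add]
    congr 1
    field_simp
    ring
  rw [bracket, e1, e2, bigTheta_nome hτ', theta1_eq hτ, ← e4, e3, ← e5]
  field_simp
  rw [Complex.I_sq]
  ring

/-! ### Coordinates -/

theorem symCoord_symProj_tmul (x y : V) :
    symCoord (symProj (x ⊗ₜ y))
      = ![x 1 * y 1, x 1 * y (-1) + x (-1) * y 1, x (-1) * y (-1)] := by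
  have h : ∀ ε₁ ε₂, tensorCoeff (symProj (x ⊗ₜ y)) ε₁ ε₂
      = 1 / 2 * (y ε₁ * x ε₂ + x ε₁ * y ε₂) := by
    intro ε₁ ε₂
    have : symProj (x ⊗ₜ[ℂ] y) = (1 / 2 : ℂ) • (y ⊗ₜ x + x ⊗ₜ y) := by simp [symProj]
    rw [this, ← tensorCoeff_tmul, ← tensorCoeff_tmul]
    simp only [tensorCoeff, map_smul, map_add, Finsupp.smul_apply, Finsupp.add_apply, smul_eq_mul]
  ext i
  fin_cases i <;> simp only [symCoord, h] <;> simp <;> ring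

theorem psi_apply (τ r u : ℂ) (a b : ℤ) (ε : ℤˣ) : psi τ r u a b ε = psiComp τ r ε u a b := by
  rcases Int.units_eq_one_or ε with rfl | rfl <;> simp [psi, v, Pi.single_apply]

theorem psiDual_v (τ r u : ℂ) (a b : ℤ) (ε : ℤˣ) :
    psiDual τ r u a b (v ε) = psiDualComp τ r ε u a b := by
  rcases Int.units_eq_one_or ε with rfl | rfl <;> simp [psiDual, v]

theorem psiDual2_v (τ r u : ℂ) (a b : ℤ) (ε₁ ε₂ : ℤˣ) :
    psiDual2 τ r u a b (v ε₁ ⊗ₜ v ε₂)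
      = psiDualComp τ r ε₁ (u + 1) (b + 1) b * psiDualComp τ r ε₂ u a (b + 1)
        + psiDualComp τ r ε₁ (u + 1) (b - 1) b * psiDualComp τ r ε₂ u a (b - 1) := by
  rw [psiDual2, Finset.sum_pair (by omega)]
  simp [psiDual_v]

theorem sum_matQ (x y : ℂ) (w : Fin 3 → ℂ) (μ : Fin 3) :
    ∑ μ', matQ x y μ' μ * w μ'
      = ![(w 0 + w 2) / 2 + y ^ 2 * ((w 0 - w 2) / 2), x ^ 2 * w 1,
          (w 0 + w 2) / 2 - y ^ 2 * ((w 0 - w 2) / 2)] μ := by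
  have h : (1 / (Real.sqrt 2 : ℂ)) * (1 / (Real.sqrt 2 : ℂ)) = 1 / 2 := by
    rw [← mul_div_mul_comm, ← Complex.ofReal_mul, Real.mul_self_sqrt (by norm_num)]
    norm_num
  simp only [matQ, gaugeU]
  generalize (1 / (Real.sqrt 2 : ℂ)) = k at h
  fin_cases μ <;> simp [Matrix.mul_apply, Fin.sum_univ_three]
  · linear_combination (w 0 + w 2 + y ^ 2 * (w 0 - w 2)) * h
  · exact Or.inl (by ring)
  · linear_combination (w 0 + w 2 - y ^ 2 * (w 0 - w 2)) * h

/-! ### Theta function identities for the fused vectors -/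

/-- `ϑ₀` and `ϑ₃` with modulus `τ/2`, indexed by a sign. -/
noncomputable def thetaSign (τ : ℂ) (ε : ℤˣ) (z : ℂ) : ℂ :=
  if ε = 1 then theta0 z (τ / 2) else theta3 z (τ / 2)

theorem thetaSign_one (τ z : ℂ) : thetaSign τ 1 z = theta0 z (τ / 2) := if_pos rfl

theorem thetaSign_neg_one (τ z : ℂ) : thetaSign τ (-1) z = theta3 z (τ / 2) :=
  if_neg (by decide)

theorem psiComp_eq (τ r : ℂ) (ε : ℤˣ) (u : ℂ) (a b : ℤ) :
    psiComp τ r ε u a b = thetaSign τ ε ((((a : ℂ) - b) * u + a) / (2 * r)) := rfl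

/-- The components of the image under `Q` of a fused vector whose two theta functions have
arguments with sum `p` and difference `q`, divided by `ϑ₃(t|τ)/ϑ₃(0|τ)`. -/
noncomputable def gaugedCoord (τ t p q : ℂ) : Fin 3 → ℂ :=
  ![theta3 0 τ / theta3 t τ * (theta3 p τ * theta3 q τ)
      + theta2 0 τ / theta2 t τ * (theta2 p τ * theta2 q τ),
    -(theta0 0 τ / theta0 t τ * (theta0 p τ * theta0 q τ)),
    theta3 0 τ / theta3 t τ * (theta3 p τ * theta3 q τ)
      - theta2 0 τ / theta2 t τ * (theta2 p τ * theta2 q τ)]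

theorem gaugedCoord_neg {τ : ℂ} (hτ : 0 < τ.im) (t p q : ℂ) :
    gaugedCoord τ t p (-q) = gaugedCoord τ t p q := by
  simp only [gaugedCoord, theta0_neg hτ, theta2_neg hτ, theta3_neg hτ]

/-- The ϑ₁ϑ₁ terms cancel because ϑ₁ is odd; symmetrization is what removes them from the fused
vector. -/
theorem thetaSign_mul_symm {τ : ℂ} (hτ : 0 < τ.im) (α β : ℂ) :
    thetaSign τ 1 α * thetaSign τ (-1) β + thetaSign τ (-1) α * thetaSign τ 1 β
      = 2 * (theta0 (α + β) τ * theta0 (α - β) τ) := by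
  rw [thetaSign_one, thetaSign_one, thetaSign_neg_one, thetaSign_neg_one,
    mul_comm (theta0 α _), theta3_mul_theta0 hτ, theta3_mul_theta0 hτ, add_comm β α,
    ← neg_sub α β, theta0_neg hτ, theta1_neg]
  ring

theorem sum_matQ_mul_symCoord_psi2 {τ r : ℂ} (hτ : 0 < τ.im)
    (h3 : theta3 (1 / r) τ ≠ 0) {x y : ℂ} (hx : x ^ 2 = xSq τ r) (hy : y ^ 2 = ySq τ r)
    (u : ℂ) (a c b : ℤ) (μ : Fin 3) {p q : ℂ}
    (hp : (((a : ℂ) - c) * (u + 1) + a + (((c : ℂ) - b) * u + c)) / (2 * r) = p)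
    (hq : (((a : ℂ) - c) * (u + 1) + a - (((c : ℂ) - b) * u + c)) / (2 * r) = q) :
    theta3 0 τ / theta3 (1 / r) τ * ∑ μ', matQ x y μ' μ * symCoord (psi2 τ r u a c b) μ'
      = gaugedCoord τ (1 / r) p q μ := by
  have h30 := theta3_zero_ne_zero hτ
  rw [add_div] at hp
  rw [sub_div] at hq
  rw [sum_matQ, psi2, symCoord_symProj_tmul, hx, hy, xSq, ySq]
  simp only [psi_apply, psiComp_eq]
  generalize (((a : ℂ) - c) * (u + 1) + a) / (2 * r) = α at hp hq
  generalize (((c : ℂ) - b) * u + c) / (2 * r) = β at hp hq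
  have e0 := theta0_mul_theta0 hτ α β
  have e3 := theta3_mul_theta3 hτ α β
  have e1 := thetaSign_mul_symm hτ α β
  rw [hp, hq] at e0 e3 e1
  rw [← thetaSign_one, ← thetaSign_one] at e0
  rw [← thetaSign_neg_one, ← thetaSign_neg_one] at e3
  fin_cases μ <;> simp [gaugedCoord, e0, e1, e3] <;> field_simp <;> ring

/-- The two signs with sum `weight μ`. -/
theorem sign_cases {P : ℤˣ → ℤˣ → Fin 3 → Prop} (h0 : P 1 1 0) (h1 : P 1 (-1) 1)
    (h1' : P (-1) 1 1) (h2 : P (-1) (-1) 2) {μ : Fin 3} {ε₁ ε₂ : ℤˣ}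
    (hμ : (ε₁ : ℤ) + (ε₂ : ℤ) = weight μ) : P ε₁ ε₂ μ := by
  rcases Int.units_eq_one_or ε₁ with rfl | rfl <;> rcases Int.units_eq_one_or ε₂ with rfl | rfl <;>
    fin_cases μ <;> first | assumption | (simp [weight] at hμ)

theorem thetaSign_mul_self {τ t : ℂ} (hτ : 0 < τ.im) (h0 : theta0 t τ ≠ 0) (h2 : theta2 t τ ≠ 0)
    (h3 : theta3 t τ ≠ 0) (w : ℂ) {μ : Fin 3} {ε₁ ε₂ : ℤˣ}
    (hμ : (ε₁ : ℤ) + (ε₂ : ℤ) = weight μ) :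
    ((ε₁ : ℤ) : ℂ) * ((ε₂ : ℤ) : ℂ) * (thetaSign τ (-ε₁) w * thetaSign τ (-ε₂) w)
      = gaugedCoord τ t (2 * w) t μ := by
  have e0 := theta0_mul_theta0 hτ w w
  have e3 := theta3_mul_theta3 hτ w w
  have e1 := theta3_mul_theta0 hτ w w
  rw [← two_mul, sub_self] at e0 e3 e1
  rw [theta1_zero, mul_zero, sub_zero] at e1
  refine sign_cases (P := fun ε₁ ε₂ μ => ((ε₁ : ℤ) : ℂ) * ((ε₂ : ℤ) : ℂ)
    * (thetaSign τ (-ε₁) w * thetaSign τ (-ε₂) w) = gaugedCoord τ t (2 * w) t μ) ?_ ?_ ?_ ?_ hμ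
  · simp [thetaSign_neg_one, gaugedCoord, e3]
    field_simp
  · simp [thetaSign_neg_one, thetaSign_one, gaugedCoord, e1]
    field_simp
  · simp [thetaSign_neg_one, thetaSign_one, gaugedCoord, mul_comm (theta0 w _), e1]
    field_simp
  · simp [thetaSign_one, gaugedCoord, e0]
    field_simp

/-- The case a = b, with z = b/r and w = u/r. In the weight 0 coordinate the ϑ₁ϑ₁ terms of the two
heights cancel, since their difference arguments are opposite; this is why the order of the two
signs does not matter. -/
theorem theta1_mul_thetaSign_mul {τ t : ℂ} (hτ : 0 < τ.im) (h0 : theta0 t τ ≠ 0)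
    (h2 : theta2 t τ ≠ 0) (h3 : theta3 t τ ≠ 0) (z w : ℂ) {μ : Fin 3} {ε₁ ε₂ : ℤˣ}
    (hμ : (ε₁ : ℤ) + (ε₂ : ℤ) = weight μ) :
    ((ε₁ : ℤ) : ℂ) * ((ε₂ : ℤ) : ℂ) * theta1 t τ
        * (theta1 (z - t) τ * (thetaSign τ (-ε₁) ((z + t + w) / 2)
            * thetaSign τ (-ε₂) ((z + t - w) / 2))
          + theta1 (z + t) τ * (thetaSign τ (-ε₁) ((z - t - w) / 2)
            * thetaSign τ (-ε₂) ((z - t + w) / 2)))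
      = theta1 (2 * t) τ * theta1 z τ * gaugedCoord τ t z w μ := by
  have sum : ∀ s w : ℂ, (s + w) / 2 + (s - w) / 2 = s := fun s w => by ring
  have diff : ∀ s w : ℂ, (s + w) / 2 - (s - w) / 2 = w := fun s w => by ring
  have sum' : ∀ s w : ℂ, (s - w) / 2 + (s + w) / 2 = s := fun s w => by ring
  have diff' : ∀ s w : ℂ, (s - w) / 2 - (s + w) / 2 = -w := fun s w => by ring
  have a0 := theta0_addition hτ z t
  have a2 := theta2_addition hτ z t
  have a3 := theta3_addition hτ z t
  generalize theta1 (2 * t) τ = d at a0 a2 a3 ⊢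
  refine sign_cases (P := fun ε₁ ε₂ μ => ((ε₁ : ℤ) : ℂ) * ((ε₂ : ℤ) : ℂ) * theta1 t τ
        * (theta1 (z - t) τ * (thetaSign τ (-ε₁) ((z + t + w) / 2)
            * thetaSign τ (-ε₂) ((z + t - w) / 2))
          + theta1 (z + t) τ * (thetaSign τ (-ε₁) ((z - t - w) / 2)
            * thetaSign τ (-ε₂) ((z - t + w) / 2)))
      = d * theta1 z τ * gaugedCoord τ t z w μ) ?_ ?_ ?_ ?_ hμ
  · rw [thetaSign_neg_one, thetaSign_neg_one, thetaSign_neg_one, thetaSign_neg_one,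
      theta3_mul_theta3 hτ, theta3_mul_theta3 hτ, sum, diff, sum', diff', theta2_neg hτ,
      theta3_neg hτ]
    simp [gaugedCoord]
    field_simp
    linear_combination theta2 t τ * theta3 w τ * a3 + theta3 t τ * theta2 w τ * a2
  · rw [neg_neg, thetaSign_neg_one, thetaSign_neg_one, thetaSign_one, thetaSign_one,
      theta3_mul_theta0 hτ, theta3_mul_theta0 hτ, sum, diff, sum', diff', theta0_neg hτ,
      theta1_neg]
    simp [gaugedCoord]
    field_simp
    linear_combination theta0 w τ * a0
  · rw [neg_neg, thetaSign_neg_one, thetaSign_neg_one, thetaSign_one, thetaSign_one,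
      mul_comm (theta0 _ (τ / 2)), mul_comm (theta0 _ (τ / 2)),
      theta3_mul_theta0 hτ, theta3_mul_theta0 hτ, add_comm ((z + t - w) / 2),
      add_comm ((z - t + w) / 2), sum, diff, sum', ← neg_sub ((z + t + w) / 2), diff,
      theta0_neg hτ, theta1_neg]
    simp [gaugedCoord]
    field_simp
    linear_combination theta0 w τ * a0
  · rw [neg_neg, thetaSign_one, thetaSign_one, thetaSign_one, thetaSign_one,
      theta0_mul_theta0 hτ, theta0_mul_theta0 hτ, sum, diff, sum', diff', theta2_neg hτ,
      theta3_neg hτ]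
    simp [gaugedCoord]
    field_simp
    linear_combination theta2 t τ * theta3 w τ * a3 - theta3 t τ * theta2 w τ * a2

/-! ### The factors `g_a / (g_b (a,b)₂)` -/

theorem bracketProd_three (τ r : ℂ) (m : ℤ) :
    bracketProd τ r (m - 1) (m + 1)
      = bracket τ r ((m - 1 : ℤ) : ℂ) * bracket τ r m * bracket τ r ((m + 1 : ℤ) : ℂ) := by
  have : Finset.Icc (m - 1) (m + 1) = {m - 1, m, m + 1} := by
    ext k
    simp only [Finset.mem_Icc, Finset.mem_insert, Finset.mem_singleton]
    omega
  rw [bracketProd, this, Finset.prod_insert (by simp; omega), Finset.prod_pair (by simp), mul_assoc]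

/-- This sign change of g between heights two apart compensates the overall minus sign of the
theorem when a - b = ±2. -/
theorem sign_mul_sign_add_two {ε : ℤ → ℤˣ} (hε : ∀ n : ℤ, ε n * ε (n + 1) = (-1) ^ n) (b : ℤ) :
    ε b * ε (b + 2) = -1 := by
  have h := congrArg₂ (· * ·) (hε b) (hε (b + 1))
  have h' : ε (b + 1) * ε (b + 1) = 1 := Int.units_mul_self _
  rw [← zpow_add, show b + (b + 1) = 2 * b + 1 by ring, zpow_add, zpow_mul, zpow_ofNat,
    neg_one_sq, one_zpow, one_mul, zpow_one, mul_mul_mul_comm, mul_comm (ε (b + 1)),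
    add_assoc b, one_add_one_eq_two, mul_mul_mul_comm, h', mul_one] at h
  exact h

section Factors

variable {τ r : ℂ} {s : ℤ → ℂ} (hs : ∀ n : ℤ, s n ^ 2 = bracket τ r n)
  {ε : ℤ → ℤˣ}

include hs

theorem gFactor_div_self {b : ℤ} (hb : s b ≠ 0) :
    gFactor s ε b / (gFactor s ε b * pairing τ r s 2 b b)
      = bracket τ r 2 / (bracket τ r 1 * (bracket τ r ((b - 1 : ℤ) : ℂ)
          * bracket τ r ((b + 1 : ℤ) : ℂ))) := by
  have hg : gFactor s ε b ≠ 0 := mul_ne_zero (by simp) hb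
  have e1 : (b + b - (2 : ℕ)) / 2 = b - 1 := by omega
  have e2 : (b + b + (2 : ℕ)) / 2 = b + 1 := by omega
  have e3 : ((b - b + (2 : ℕ)) / 2).toNat = 1 := by omega
  have e4 : s b * s b = bracket τ r b := by rw [← hs, sq]
  have hb' : bracket τ r b ≠ 0 := by rw [← e4]; exact mul_ne_zero hb hb
  rw [← div_div, div_self hg, pairing, e1, e2, e3, bracketProd_three, e4, bracketBinom]
  simp
  field_simp

/-- The pairing `(a,b)₂` for `a - b = ±2`, with `m = (a+b)/2`. -/
theorem gFactor_div_of_bracketBinom_eq_one {a b m : ℤ} (hm : a + b = 2 * m)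
    (hB : bracketBinom τ r 2 ((a - b + (2 : ℕ)) / 2).toNat = 1) (hε : ε b * ε a = -1)
    (hb : s b ≠ 0) :
    gFactor s ε a / (gFactor s ε b * pairing τ r s 2 a b)
      = -(bracket τ r a / (bracket τ r ((m - 1 : ℤ) : ℂ) * bracket τ r m
          * bracket τ r ((m + 1 : ℤ) : ℂ))) := by
  have e1 : (a + b - (2 : ℕ)) / 2 = m - 1 := by omega
  have e2 : (a + b + (2 : ℕ)) / 2 = m + 1 := by omega
  have e3 : ((ε a : ℤ) : ℂ) = -((ε b : ℤ) : ℂ) := by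
    have : ε a = -ε b := by
      rw [← mul_left_cancel_iff (a := ε b), hε, mul_neg, Int.units_mul_self]
    rw [this]
    simp
  have e4 : ((ε b : ℤ) : ℂ) ≠ 0 := by simp
  rw [pairing, e1, e2, hB, bracketProd_three, gFactor, gFactor, e3, ← hs a]
  generalize bracket τ r ((m - 1 : ℤ) : ℂ) * bracket τ r m * bracket τ r ((m + 1 : ℤ) : ℂ) = D
  rw [inv_one, one_mul, mul_div_assoc', div_div_eq_mul_div, neg_mul, neg_mul, neg_div, neg_inj]
  -- If D = 0, both sides are 0 by the convention for division by zero.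
  rcases eq_or_ne D 0 with rfl | hD
  · simp
  rcases eq_or_ne (s a) 0 with ha | ha
  · simp [ha]
  field_simp

end Factors

theorem psiDualComp_add_one_mul (τ r u : ℂ) (ε₁ ε₂ : ℤˣ) {a c b : ℤ} (hcb : |c - b| = 1)
    (hac : |a - c| = 1) :
    psiDualComp τ r ε₁ (u + 1) c b * psiDualComp τ r ε₂ u a c
      = bracketConst τ r ^ 4 / (4 * bracket τ r u * bracket τ r (u + 1))
        * (((c : ℂ) - b) * ((a : ℂ) - c) / (bracket τ r b * bracket τ r c))
        * (((ε₁ : ℤ) : ℂ) * ((ε₂ : ℤ) : ℂ)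
          * (thetaSign τ (-ε₁) ((((c : ℂ) - b) * u + c) / (2 * r))
            * thetaSign τ (-ε₂) ((((a : ℂ) - c) * (u - 1) + a) / (2 * r)))) := by
  rw [psiDualComp, psiDualComp, if_pos hcb, if_pos hac, psiComp_eq, psiComp_eq, add_sub_cancel_right]
  ring

theorem psiDualComp_eq_zero (τ r u : ℂ) (ε : ℤˣ) {a b : ℤ} (h : |a - b| ≠ 1) :
    psiDualComp τ r ε u a b = 0 := if_neg h

theorem psiDual2_apply_of_bracketBinom_eq_one {τ r : ℂ} (hτ : 0 < τ.im)
    (h0 : theta0 (1 / r) τ ≠ 0) (h2 : theta2 (1 / r) τ ≠ 0) (h3 : theta3 (1 / r) τ ≠ 0)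
    {s : ℤ → ℂ} (hs : ∀ n : ℤ, s n ^ 2 = bracket τ r n) {ε : ℤ → ℤˣ} {x y : ℂ}
    (hx : x ^ 2 = xSq τ r) (hy : y ^ 2 = ySq τ r) (u : ℂ) {a b c : ℤ} {δ : ℤ}
    (hδ : |δ| = 1) (hc : c = b + δ) (ha : a = b + 2 * δ)
    (hB : bracketBinom τ r 2 ((a - b + (2 : ℕ)) / 2).toNat = 1) (hε : ε b * ε a = -1)
    (hba : bracket τ r a ≠ 0) (hbb : bracket τ r b ≠ 0)
    {μ : Fin 3} {ε₁ ε₂ : ℤˣ} (hμ : (ε₁ : ℤ) + (ε₂ : ℤ) = weight μ) :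
    psiDual2 τ r u a b (v ε₁ ⊗ₜ v ε₂) =
      -(bracketConst τ r ^ 4 / (4 * bracket τ r u * bracket τ r (u + 1)))
        * (theta3 0 τ / theta3 (1 / r) τ)
        * (gFactor s ε a / (gFactor s ε b * pairing τ r s 2 a b))
        * ∑ μ' : Fin 3, matQ x y μ' μ * symCoord (psi2 τ r (u - 1) a c b) μ' := by
  have hsb : s b ≠ 0 := fun h => hbb (by rw [← hs, h]; simp)
  have hG := gFactor_div_of_bracketBinom_eq_one hs (a := a) (b := b) (m := c) (by omega) hB hε hsb
  have hG' : gFactor s ε a / (gFactor s ε b * pairing τ r s 2 a b)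
      = -(bracket τ r b * bracket τ r c)⁻¹ := by
    rw [hG]
    -- The heights c ± 1 are a and b, so [a] cancels.
    rcases (abs_eq zero_le_one).1 hδ with rfl | rfl
    · rw [show c - 1 = b by omega, show c + 1 = a by omega]
      field_simp
    · rw [show c - 1 = a by omega, show c + 1 = b by omega]
      field_simp
  have hδ2 : (δ : ℂ) * δ = 1 := by
    rcases (abs_eq zero_le_one).1 hδ with rfl | rfl <;> simp
  have hL : psiDual2 τ r u a b (v ε₁ ⊗ₜ v ε₂)
      = psiDualComp τ r ε₁ (u + 1) c b * psiDualComp τ r ε₂ u a c := by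
    rw [psiDual2_v]
    -- The other neighbour of b is at distance 3 from a, where the dual component is 0 by
    -- definition.
    rcases (abs_eq zero_le_one).1 hδ with rfl | rfl
    · rw [psiDualComp_eq_zero (a := a) (b := b - 1) _ _ _ _
        (by rw [show a - (b - 1) = 3 by omega]; decide), mul_zero, add_zero, hc]
    · rw [psiDualComp_eq_zero (a := a) (b := b + 1) _ _ _ _
        (by rw [show a - (b + 1) = -3 by omega]; decide), mul_zero, zero_add, hc,
        sub_eq_add_neg]
  have hQ : gaugedCoord τ (1 / r) (2 * ((δ * u + c) / (2 * r))) (1 / r) μ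
      = theta3 0 τ / theta3 (1 / r) τ
        * ∑ μ' : Fin 3, matQ x y μ' μ * symCoord (psi2 τ r (u - 1) a c b) μ' := by
    rw [sum_matQ_mul_symCoord_psi2 hτ h3 hx hy (u - 1) a c b μ
      (p := 2 * ((δ * u + c) / (2 * r))) (q := δ * (1 / r))]
    · rcases (abs_eq zero_le_one).1 hδ with rfl | rfl
      · simp
      · rw [Int.cast_neg, Int.cast_one, neg_one_mul, neg_one_mul, gaugedCoord_neg hτ]
    · rw [ha, hc]; push_cast; ring
    · rw [ha, hc]; push_cast; field_simp; ring
  rw [hL, psiDualComp_add_one_mul _ _ _ _ _ (by rw [hc]; simpa using hδ)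
    (by rw [ha, hc]; ring_nf; exact hδ), mul_right_comm _ (theta3 0 τ / _),
    mul_assoc _ (theta3 0 τ / _), ← hQ, ← thetaSign_mul_self hτ h0 h2 h3 _ hμ, hG']
  have a1 : (c : ℂ) - b = δ := by rw [hc]; push_cast; ring
  have a2 : (a : ℂ) - c = δ := by rw [ha, hc]; push_cast; ring
  have a3 : (δ : ℂ) * (u - 1) + a = δ * u + c := by linear_combination a2
  rw [a1, a2, a3, hδ2]
  ring

theorem psiDual2_apply_self {τ r : ℂ} (hτ : 0 < τ.im) (hr : r ≠ 0)
    (h0 : theta0 (1 / r) τ ≠ 0) (h2 : theta2 (1 / r) τ ≠ 0) (h3 : theta3 (1 / r) τ ≠ 0)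
    (hb1 : bracket τ r 1 ≠ 0)
    {s : ℤ → ℂ} (hs : ∀ n : ℤ, s n ^ 2 = bracket τ r n) {ε : ℤ → ℤˣ} {x y : ℂ}
    (hx : x ^ 2 = xSq τ r) (hy : y ^ 2 = ySq τ r) (u : ℂ) {b c : ℤ} (hcb : |c - b| = 1)
    (hbb : bracket τ r b ≠ 0) (hbp : bracket τ r ((b + 1 : ℤ) : ℂ) ≠ 0)
    (hbm : bracket τ r ((b - 1 : ℤ) : ℂ) ≠ 0)
    {μ : Fin 3} {ε₁ ε₂ : ℤˣ} (hμ : (ε₁ : ℤ) + (ε₂ : ℤ) = weight μ) :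
    psiDual2 τ r u b b (v ε₁ ⊗ₜ v ε₂) =
      -(bracketConst τ r ^ 4 / (4 * bracket τ r u * bracket τ r (u + 1)))
        * (theta3 0 τ / theta3 (1 / r) τ)
        * (gFactor s ε b / (gFactor s ε b * pairing τ r s 2 b b))
        * ∑ μ' : Fin 3, matQ x y μ' μ * symCoord (psi2 τ r (u - 1) b c b) μ' := by
  have hsb : s b ≠ 0 := fun h => hbb (by rw [← hs, h]; simp)
  have hQ : gaugedCoord τ (1 / r) (b / r) (u / r) μ
      = theta3 0 τ / theta3 (1 / r) τ
        * ∑ μ' : Fin 3, matQ x y μ' μ * symCoord (psi2 τ r (u - 1) b c b) μ' := by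
    rw [sum_matQ_mul_symCoord_psi2 hτ h3 hx hy (u - 1) b c b μ
      (p := b / r) (q := (b - c) * (u / r))]
    · rcases (abs_eq zero_le_one).1 hcb with h | h
      · rw [show (b : ℂ) - c = -1 by rw [show c = b + 1 by omega]; push_cast; ring,
          neg_one_mul, gaugedCoord_neg hτ]
      · rw [show (b : ℂ) - c = 1 by rw [show c = b - 1 by omega]; push_cast; ring, one_mul]
    · field_simp; ring
    · field_simp; ring
  obtain ⟨K, hK⟩ := exists_bracket_eq hτ hr
  have key := theta1_mul_thetaSign_mul hτ h0 h2 h3 (b / r) (u / r) hμ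
  rw [psiDual2_v, psiDualComp_add_one_mul _ _ _ _ _ (by simp) (by simp),
    psiDualComp_add_one_mul _ _ _ _ _ (by simp) (by simp), mul_right_comm _ (theta3 0 τ / _),
    mul_assoc _ (theta3 0 τ / _), ← hQ, gFactor_div_self hs hsb]
  have a1 : ((((b + 1 : ℤ) : ℂ) - b) * u + (b + 1 : ℤ)) / (2 * r)
      = (b / r + 1 / r + u / r) / 2 := by push_cast; field_simp; ring
  have a2 : (((b : ℂ) - (b + 1 : ℤ)) * (u - 1) + b) / (2 * r)
      = (b / r + 1 / r - u / r) / 2 := by push_cast; field_simp; ring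
  have a3 : ((((b - 1 : ℤ) : ℂ) - b) * u + (b - 1 : ℤ)) / (2 * r)
      = (b / r - 1 / r - u / r) / 2 := by push_cast; field_simp; ring
  have a4 : (((b : ℂ) - (b - 1 : ℤ)) * (u - 1) + b) / (2 * r)
      = (b / r - 1 / r + u / r) / 2 := by push_cast; field_simp; ring
  have c1 : (((b + 1 : ℤ) : ℂ) - b) * ((b : ℂ) - (b + 1 : ℤ)) = -1 := by push_cast; ring
  have c2 : (((b - 1 : ℤ) : ℂ) - b) * ((b : ℂ) - (b - 1 : ℤ)) = -1 := by push_cast; ring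
  have k1 := hK 1
  have k2 : bracket τ r 2 = K * theta1 (2 * (1 / r)) τ := by rw [hK, mul_one_div]
  have k3 : bracket τ r ((b + 1 : ℤ) : ℂ) = K * theta1 (b / r + 1 / r) τ := by
    rw [hK]; push_cast; rw [add_div]
  have k4 : bracket τ r ((b - 1 : ℤ) : ℂ) = K * theta1 (b / r - 1 / r) τ := by
    rw [hK]; push_cast; rw [sub_div]
  have k5 := hK b
  rw [a1, a2, a3, a4, c1, c2]
  generalize thetaSign τ (-ε₁) _ * thetaSign τ (-ε₂) _ = T at key ⊢
  generalize thetaSign τ (-ε₁) _ * thetaSign τ (-ε₂) _ = T' at key ⊢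
  generalize ((ε₁ : ℤ) : ℂ) * ((ε₂ : ℤ) : ℂ) = E at key ⊢
  generalize bracketConst τ r ^ 4 / _ = X
  generalize gaugedCoord τ (1 / r) (b / r) (u / r) μ = W at key ⊢
  -- Both sides have degree two in the brackets, so the constant enters only as K².
  have key' : E * bracket τ r 1 * (bracket τ r ((b - 1 : ℤ) : ℂ) * T
      + bracket τ r ((b + 1 : ℤ) : ℂ) * T') = bracket τ r 2 * bracket τ r b * W := by
    rw [k1, k2, k3, k4, k5]
    linear_combination K ^ 2 * key
  clear k1 k2 k3 k4 k5 hQ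
  generalize bracket τ r ((b + 1 : ℤ) : ℂ) = Bp at *
  generalize bracket τ r ((b - 1 : ℤ) : ℂ) = Bm at *
  field_simp
  linear_combination -X * key'

end VertexFace

theorem mainTheorem3 (τ r : ℂ) (hτ : 0 < τ.im) (hr : r ≠ 0)
    (h2 : bracket τ r 2 ≠ 0)
    -- a choice of square roots of the numbers `[n]`, and the signs in `g_a`
    (s : ℤ → ℂ) (hs : ∀ n : ℤ, s n ^ 2 = bracket τ r n)
    (ε : ℤ → ℤˣ) (hε : ∀ n : ℤ, ε n * ε (n + 1) = (-1) ^ n)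
    -- the entries of the gauge matrix
    (x y : ℂ) (hx : x ^ 2 = xSq τ r) (hy : y ^ 2 = ySq τ r)
    (u : ℂ) (hu : bracket τ r u ≠ 0) (hu1 : bracket τ r (u + 1) ≠ 0)
    -- admissible heights and an intermediate height
    (a b c : ℤ) (hac : |a - c| = 1) (hcb : |c - b| = 1)
    (hab : ∀ k ∈ Finset.Icc ((a + b) / 2 - 1) ((a + b) / 2 + 1), bracket τ r (k : ℤ) ≠ 0)
    (μ : Fin 3) (ε₁ ε₂ : ℤˣ) (hμ : (ε₁ : ℤ) + (ε₂ : ℤ) = weight μ) :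
    psiDual2 τ r u a b (v ε₁ ⊗ₜ v ε₂) =
      -(bracketConst τ r ^ 4 / (4 * bracket τ r u * bracket τ r (u + 1)))
        * (theta3 0 τ / theta3 (1 / r) τ)
        * (gFactor s ε a / (gFactor s ε b * pairing τ r s 2 a b))
        * ∑ μ' : Fin 3, matQ x y μ' μ * symCoord (psi2 τ r (u - 1) a c b) μ' := by
  obtain ⟨K, hK⟩ := exists_bracket_eq hτ hr
  have hK0 : K ≠ 0 := by
    rintro rfl
    exact h2 (by rw [hK, zero_mul])
  have ht : theta1 (2 * (1 / r)) τ ≠ 0 := by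
    intro h
    exact h2 (by rw [hK, ← mul_one_div, h, mul_zero])
  have t12 := theta1_mul_theta2_ne_zero hτ ht
  have t0 := theta0_ne_zero_of_theta1_two_mul_ne_zero hτ ht
  have t3 := theta3_ne_zero_of_theta1_two_mul_ne_zero hτ ht
  have t1 := left_ne_zero_of_mul t12
  have t2 := right_ne_zero_of_mul t12
  have hb1 : bracket τ r 1 ≠ 0 := by
    rw [hK]
    exact mul_ne_zero hK0 t1
  -- Two of the four choices of steps a → c → b return to the same height.
  have same : a = b → psiDual2 τ r u a b (v ε₁ ⊗ₜ v ε₂) =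
      -(bracketConst τ r ^ 4 / (4 * bracket τ r u * bracket τ r (u + 1)))
        * (theta3 0 τ / theta3 (1 / r) τ)
        * (gFactor s ε a / (gFactor s ε b * pairing τ r s 2 a b))
        * ∑ μ' : Fin 3, matQ x y μ' μ * symCoord (psi2 τ r (u - 1) a c b) μ' := by
    rintro rfl
    exact psiDual2_apply_self hτ hr t0 t2 t3 hb1 hs hx hy u hcb
      (hab a (by rw [Finset.mem_Icc]; omega)) (hab (a + 1) (by rw [Finset.mem_Icc]; omega))
      (hab (a - 1) (by rw [Finset.mem_Icc]; omega)) hμ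
  -- The heights a and b differ from (a + b)/2 by at most 1, so they lie in the range covered by
  -- `hab`.
  have hba : bracket τ r a ≠ 0 := hab a (by
    rw [Finset.mem_Icc]; rw [abs_eq zero_le_one] at hac hcb; omega)
  have hbb : bracket τ r b ≠ 0 := hab b (by
    rw [Finset.mem_Icc]; rw [abs_eq zero_le_one] at hac hcb; omega)
  rcases (abs_eq zero_le_one).1 hac with h | h <;> rcases (abs_eq zero_le_one).1 hcb with h' | h'
  · obtain rfl : a = b + 2 := by omega
    refine psiDual2_apply_of_bracketBinom_eq_one hτ t0 t2 t3 hs hx hy u (δ := 1) (by simp)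
      (by omega) (by omega) ?_ (sign_mul_sign_add_two hε b) hba hbb hμ
    rw [show ((b + 2 - b + (2 : ℕ)) / 2).toNat = 2 by omega, bracketBinom]
    simp [Finset.prod_range_succ]
    norm_num
    field_simp
  · exact same (by omega)
  · exact same (by omega)
  · obtain rfl : b = a + 2 := by omega
    refine psiDual2_apply_of_bracketBinom_eq_one hτ t0 t2 t3 hs hx hy u (δ := -1) (by simp)
      (by omega) (by omega) ?_ ?_ hba hbb hμ
    · rw [show ((a - (a + 2) + (2 : ℕ)) / 2).toNat = 0 by omega, bracketBinom]
      simp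
    · rw [mul_comm, sign_mul_sign_add_two hε a]
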